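/- **Theorem (Differentiability of $D_2$).** For positive semi-definite real matrices $A,B$ of the same size let $A^{1/2}$ be the positive semi-definite square root of $A$ and let $d_W^2(A,B)=\operatorname{tr}A+\operatorname{tr}B-2\operatorname{tr}\bigl((A^{1/2}BA^{1/2})^{1/2}\bigr)$ be the squared Bures–Wasserstein distance. Let $p,q\ge 1$ and $d=p+q$. For a $d\times d$ matrix $A=\begin{bmatrix}A_{11}&A_{12}\\A_{21}&A_{22}\end{bmatrix}$ with diagonal blocks of sizes $p\times p$ and $q\times q$ put $A_0=\begin{bmatrix}A_{11}&0\\0&A_{22}\end{bmatrix}$. Let $\Gamma(\Sigma_1,\Sigma_2)$ be the set of positive semi-definite symmetric $d\times d$ matrices with diagonal blocks $\Sigma_1$ and $\Sigma_2$, and for positive semi-definite $\Sigma$ with non-zero diagonal blocks $\Sigma_1,\Sigma_2$ define $$D_2(\Sigma)=\frac{d_W^2(\Sigma,\Sigma_0)}{\sup_{\tilde\Sigma\in\Gamma(\Sigma_1,\Sigma_2)}d_W^2(\tilde\Sigma,\Sigma_0)}.$$ Let $\Sigma$ be a symmetric positive definite $d\times d$ matrix with diagonal blocks $\Sigma_1$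 ($p\times p$) and $\Sigma_2$ ($q\times q$), and let $\Sigma_r=U_r\Lambda_rU_r^\top$, $r\in\{1,2\}$, with $U_r$ orthogonal, $\Lambda_1=\operatorname{diag}(\lambda_{1,1},\dots,\lambda_{p,1})$ and $\Lambda_2=\operatorname{diag}(\lambda_{1,2},\dots,\lambda_{q,2})$, the eigenvalues being in decreasing order. Assume that $\Sigma_1$ has $p$ distinct eigenvalues and that $\Sigma_2$ has $q$ distinct eigenvalues. Put $\lambda_{j,1}=0$ for $j>p$ and $\lambda_{j,2}=0$ for $j>q$. Let $$\Sigma_m=\begin{bmatrix}\Sigma_1&\Psi_m\\\Psi_m^\top&\Sigma_2\end{bmatrix},\qquad \Psi_m=U_1\Lambda_1^{1/2}\,\Pi\,\Lambda_2^{1/2}U_2^\top,\qquad \Pi=(\mathbf 1\{i=j\})_{i\le p,\,j\le q},$$ $$c_2=\operatorname{tr}(\Sigma)-\operatorname{tr}\bigl((\Sigma_0^{1/2}\Sigma_m\Sigma_0^{1/2})^{1/2}\bigr),\qquad J=\Sigma_0^{-1/2}\bigl(\Sigma_0^{1/2}\Sigma\Sigma_0^{1/2}\bigr)^{1/2}\Sigma_0^{-1/2},$$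 $$\Delta_1'=\operatorname{diag}\Bigl(\tfrac{\lambda_{j,1}}{(\lambda_{j,1}^2+\lambda_{j,2}^2)^{1/2}}\Bigr)_{j=1}^p,\qquad \Delta_2'=\operatorname{diag}\Bigl(\tfrac{\lambda_{j,2}}{(\lambda_{j,1}^2+\lambda_{j,2}^2)^{1/2}}\Bigr)_{j=1}^q,\qquad \Upsilon_2=\begin{bmatrix}U_1\Delta_1'U_1^\top&0\\0&U_2\Delta_2'U_2^\top\end{bmatrix},$$ $$M_2=\frac1{c_2}\Bigl(-\tfrac12\bigl(J_0+J^{-1}\bigr)+\bigl(1-D_2(\Sigma)\bigr)I_d+D_2(\Sigma)\,\Upsilon_2\Bigr).$$ Let $H$ and $H_t$, $t>0$, be real symmetric $d\times d$ matrices such that $H_t\to H$ element-wise as $t\downarrow0$. Then $$\lim_{t\downarrow0}t^{-1}\bigl(D_2(\Sigma+tH_t)-D_2(\Sigma)\bigr)=\operatorname{tr}(M_2H).$$ -/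

import Mathlib

open Matrix Filter Topology
open scoped MatrixOrder

noncomputable section

namespace QuasiGaussian

/-- The square root `A^{1/2}` of a positive semi-definite real matrix: the unique positive
semi-definite matrix whose square is `A`. -/
def msqrt {n : Type*} [Fintype n] [DecidableEq n] (A : Matrix n n ℝ) : Matrix n n ℝ :=
  CFC.sqrt A

/-- For positive semi-definite `A`, `msqrt A` is a positive semi-definite square root of `A`. -/
theorem msqrt_spec {n : Type*} [Fintype n] [DecidableEq n] {A : Matrix n n ℝ}
    (hA : A.PosSemidef) : (msqrt A).PosSemidef ∧ msqrt A * msqrt A = A :=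
  ⟨Matrix.nonneg_iff_posSemidef.mp (CFC.sqrt_nonneg A), CFC.sqrt_mul_sqrt_self A hA.nonneg⟩

/-- The squared Bures--Wasserstein distance
`d_W²(A, B) = tr A + tr B - 2 tr ((A^{1/2} B A^{1/2})^{1/2})`. -/
def buresSq {n : Type*} [Fintype n] [DecidableEq n] (A B : Matrix n n ℝ) : ℝ :=
  A.trace + B.trace - 2 * (msqrt (msqrt A * B * msqrt A)).trace

variable {p q : ℕ}

/-- `A₀`: the matrix `A` with its off-diagonal blocks replaced by zero. -/
def blockPart (A : Matrix (Fin p ⊕ Fin q) (Fin p ⊕ Fin q) ℝ) :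
    Matrix (Fin p ⊕ Fin q) (Fin p ⊕ Fin q) ℝ :=
  fromBlocks A.toBlocks₁₁ 0 0 A.toBlocks₂₂

/-- `Γ(S₁, S₂)`: the positive semi-definite matrices with diagonal blocks `S₁` and `S₂`. -/
def couplings (S₁ : Matrix (Fin p) (Fin p) ℝ) (S₂ : Matrix (Fin q) (Fin q) ℝ) :
    Set (Matrix (Fin p ⊕ Fin q) (Fin p ⊕ Fin q) ℝ) :=
  {T | T.PosSemidef ∧ ∃ Ψ : Matrix (Fin p) (Fin q) ℝ, T = fromBlocks S₁ Ψ Ψᵀ S₂}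

/-- The quasi-Gaussian Wasserstein dependence coefficient `D₂(S; p, q)`. -/
def depTwo (S : Matrix (Fin p ⊕ Fin q) (Fin p ⊕ Fin q) ℝ) : ℝ :=
  buresSq S (blockPart S) /
    sSup ((fun T => buresSq T (blockPart S)) '' couplings S.toBlocks₁₁ S.toBlocks₂₂)

/-- `A = U diag(l) Uᵀ` with `U` orthogonal and `l` in decreasing order. -/
structure IsEigendecomposition {n : ℕ} (A U : Matrix (Fin n) (Fin n) ℝ) (l : Fin n → ℝ) :
    Prop where
  orthogonal : U ∈ Matrix.orthogonalGroup (Fin n) ℝ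
  ordered : Antitone l
  eq : A = U * diagonal l * Uᵀ

/-- `Ψ_m = U₁ Λ₁^{1/2} Π Λ₂^{1/2} U₂ᵀ`, where `Π` is the `p × q` matrix with ones on the main
diagonal and zeros elsewhere. -/
def maxCross (U₁ : Matrix (Fin p) (Fin p) ℝ) (l₁ : Fin p → ℝ)
    (U₂ : Matrix (Fin q) (Fin q) ℝ) (l₂ : Fin q → ℝ) : Matrix (Fin p) (Fin q) ℝ :=
  U₁ * diagonal (fun i => √(l₁ i)) *
    (Matrix.of fun (i : Fin p) (j : Fin q) => if (i : ℕ) = (j : ℕ) then (1 : ℝ) else 0) *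
    diagonal (fun j => √(l₂ j)) * U₂ᵀ

/-- `S_m`: the diagonal blocks of `S`, and the off-diagonal block `Ψ_m`. -/
def maxCoupling (S : Matrix (Fin p ⊕ Fin q) (Fin p ⊕ Fin q) ℝ)
    (U₁ : Matrix (Fin p) (Fin p) ℝ) (l₁ : Fin p → ℝ)
    (U₂ : Matrix (Fin q) (Fin q) ℝ) (l₂ : Fin q → ℝ) :
    Matrix (Fin p ⊕ Fin q) (Fin p ⊕ Fin q) ℝ :=
  fromBlocks S.toBlocks₁₁ (maxCross U₁ l₁ U₂ l₂) (maxCross U₁ l₁ U₂ l₂)ᵀ S.toBlocks₂₂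

/-- `c₂ = tr S - tr ((S₀^{1/2} S_m S₀^{1/2})^{1/2})`. -/
def cTwo (S : Matrix (Fin p ⊕ Fin q) (Fin p ⊕ Fin q) ℝ)
    (U₁ : Matrix (Fin p) (Fin p) ℝ) (l₁ : Fin p → ℝ)
    (U₂ : Matrix (Fin q) (Fin q) ℝ) (l₂ : Fin q → ℝ) : ℝ :=
  S.trace -
    (msqrt (msqrt (blockPart S) * maxCoupling S U₁ l₁ U₂ l₂ * msqrt (blockPart S))).trace

/-- `J = S₀^{-1/2} (S₀^{1/2} S S₀^{1/2})^{1/2} S₀^{-1/2}`. -/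
def transportJ (S : Matrix (Fin p ⊕ Fin q) (Fin p ⊕ Fin q) ℝ) :
    Matrix (Fin p ⊕ Fin q) (Fin p ⊕ Fin q) ℝ :=
  (msqrt (blockPart S))⁻¹ * msqrt (msqrt (blockPart S) * S * msqrt (blockPart S)) *
    (msqrt (blockPart S))⁻¹

/-- The `j`-th entry of a vector, and zero beyond its length. -/
def pad {n : ℕ} (l : Fin n → ℝ) (j : ℕ) : ℝ :=
  if h : j < n then l ⟨j, h⟩ else 0

/-- The diagonal matrix with entries `l_j / (l_j² + k_j²)^{1/2}`, where `k_j = 0` beyond the length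
of `k`; for `l > 0` the entries beyond the length of `k` are therefore `1`. With `(l, k)` equal to
`(λ₁, λ₂)` and to `(λ₂, λ₁)` these are `Δ₁'` and `Δ₂'`. -/
def deltaPrime {n m : ℕ} (l : Fin n → ℝ) (k : Fin m → ℝ) : Matrix (Fin n) (Fin n) ℝ :=
  diagonal fun j => l j / √(l j ^ 2 + pad k j ^ 2)

/-- `Υ₂`: block diagonal with blocks `U₁ Δ₁' U₁ᵀ` and `U₂ Δ₂' U₂ᵀ`. -/
def upsilonTwo (U₁ : Matrix (Fin p) (Fin p) ℝ) (l₁ : Fin p → ℝ)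
    (U₂ : Matrix (Fin q) (Fin q) ℝ) (l₂ : Fin q → ℝ) :
    Matrix (Fin p ⊕ Fin q) (Fin p ⊕ Fin q) ℝ :=
  fromBlocks (U₁ * deltaPrime l₁ l₂ * U₁ᵀ) 0 0 (U₂ * deltaPrime l₂ l₁ * U₂ᵀ)

/-- `M₂ = c₂⁻¹ (-(J₀ + J⁻¹)/2 + (1 - D₂(S)) I + D₂(S) Υ₂)`. -/
def MTwo (S : Matrix (Fin p ⊕ Fin q) (Fin p ⊕ Fin q) ℝ)
    (U₁ : Matrix (Fin p) (Fin p) ℝ) (l₁ : Fin p → ℝ)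
    (U₂ : Matrix (Fin q) (Fin q) ℝ) (l₂ : Fin q → ℝ) :
    Matrix (Fin p ⊕ Fin q) (Fin p ⊕ Fin q) ℝ :=
  (1 / cTwo S U₁ l₁ U₂ l₂) •
    (-((1 / 2 : ℝ) • (blockPart (transportJ S) + (transportJ S)⁻¹))
      + (1 - depTwo S) • (1 : Matrix (Fin p ⊕ Fin q) (Fin p ⊕ Fin q) ℝ)
      + depTwo S • upsilonTwo U₁ l₁ U₂ l₂)

end QuasiGaussian

end

/-! Write F(A,B) for the fidelity, the sum of the square roots of the eigenvalues of AB, so that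
d_W² = tr A + tr B - 2F. The supremum in the denominator is attained at Σ_m, where F takes its least
value G = ∑ₖ (λ_{k,1}² + λ_{k,2}²)^{1/2}. Hence D₂ = (tr Σ - F(Σ,Σ₀)) / (tr Σ - G) (`depTwo_eq`),
and the result is the quotient rule once F and G are differentiated.

F is handled by an envelope argument. For positive definite X, 2F(A,B) ≤ tr(AX⁻¹) + tr(BX), with
equality at the transport map X = J (`two_mul_fidelity_le`). Using the map at time t as a trial at
time 0, and conversely, squeezes the difference quotient; continuity of J suffices, and J need not
be differentiated (`tendsto_slope_fidelity`).

The lower bound F ≥ G is a majorization statement: after rotation, ΣΣ₀ has the spectrum of a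
positive semi-definite matrix with diagonal blocks Λ₁² and Λ₂², and concavity of the square root
with a rearrangement inequality bounds the sum of its root eigenvalues
(`sum_sqrt_le_of_diagonal_blocks`, `minFidelity_le`). Equality at Σ_m is an explicit factorization
(`fidelity_maxCoupling`).

G is a function of the block eigenvalues. These are simple, so each has first-order change (Uᵀ H
U)ᵢᵢ, with H the corresponding block (`tendsto_slope_eigenvalue`), proved by inserting the
first-order perturbed eigenvector into a residual bound. -/

namespace QuasiGaussian

/-! ### Matrix square roots and the fidelity -/

section Sqrt

variable {n : Type*} [Fintype n] [DecidableEq n]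

theorem msqrt_eq_of_mul_self {A B : Matrix n n ℝ} (hB : B.PosSemidef) (h : B * B = A) :
    msqrt A = B :=
  CFC.sqrt_unique h hB.nonneg

theorem posSemidef_msqrt (A : Matrix n n ℝ) : (msqrt A).PosSemidef :=
  Matrix.nonneg_iff_posSemidef.mp (CFC.sqrt_nonneg A)

theorem msqrt_mul_self {A : Matrix n n ℝ} (hA : A.PosSemidef) : msqrt A * msqrt A = A :=
  (msqrt_spec hA).2

theorem transpose_msqrt (A : Matrix n n ℝ) : (msqrt A)ᵀ = msqrt A := by
  simpa [conjTranspose_eq_transpose_of_trivial] using (posSemidef_msqrt A).isHermitian.eq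

theorem posDef_msqrt {A : Matrix n n ℝ} (hA : A.PosDef) : (msqrt A).PosDef := by
  rw [(posSemidef_msqrt A).posDef_iff_isUnit]
  have h := hA.isUnit
  rw [← msqrt_mul_self hA.posSemidef] at h
  exact isUnit_of_mul_isUnit_left h

theorem _root_.Matrix.PosSemidef.mul_mul_transpose {n m : Type*} [Fintype n] [Fintype m]
    {A : Matrix n n ℝ} (hA : A.PosSemidef)
    (B : Matrix m n ℝ) : (B * A * Bᵀ).PosSemidef := by
  simpa [conjTranspose_eq_transpose_of_trivial] using hA.mul_mul_conjTranspose_same B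

theorem _root_.Matrix.PosSemidef.transpose_mul_mul {n m : Type*} [Fintype n] [Fintype m]
    {A : Matrix n n ℝ} (hA : A.PosSemidef)
    (B : Matrix n m ℝ) : (Bᵀ * A * B).PosSemidef := by
  simpa [conjTranspose_eq_transpose_of_trivial] using hA.conjTranspose_mul_mul_same B

theorem _root_.Matrix.PosSemidef.msqrt_mul_mul_msqrt {A : Matrix n n ℝ} (hA : A.PosSemidef)
    (B : Matrix n n ℝ) : (msqrt B * A * msqrt B).PosSemidef := by
  simpa [transpose_msqrt] using hA.mul_mul_transpose (msqrt B)

theorem _root_.Matrix.IsHermitian.exists_orthogonal_diagonal {A : Matrix n n ℝ}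
    (hA : A.IsHermitian) :
    ∃ U : Matrix n n ℝ, Uᵀ * U = 1 ∧ U * Uᵀ = 1 ∧ A = U * diagonal hA.eigenvalues * Uᵀ := by
  refine ⟨hA.eigenvectorUnitary, ?_, ?_, ?_⟩
  · simpa [star_eq_conjTranspose, conjTranspose_eq_transpose_of_trivial] using
      Unitary.coe_star_mul_self hA.eigenvectorUnitary
  · simpa [star_eq_conjTranspose, conjTranspose_eq_transpose_of_trivial] using
      Unitary.coe_mul_star_self hA.eigenvectorUnitary
  · simpa [Unitary.conjStarAlgAut_apply, star_eq_conjTranspose,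
      conjTranspose_eq_transpose_of_trivial, Function.comp_def] using hA.spectral_theorem

theorem msqrt_conj_diagonal {U : Matrix n n ℝ} (hU : Uᵀ * U = 1) {e : n → ℝ} (he : ∀ i, 0 ≤ e i) :
    msqrt (U * diagonal e * Uᵀ) = U * diagonal (fun i => √(e i)) * Uᵀ := by
  apply msqrt_eq_of_mul_self
  · exact (PosSemidef.diagonal (fun i => Real.sqrt_nonneg (e i))).mul_mul_transpose U
  · calc _ = U * diagonal (fun i => √(e i)) * (Uᵀ * U) * diagonal (fun i => √(e i)) * Uᵀ := by
          simp only [Matrix.mul_assoc]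
      _ = _ := by
          rw [hU, Matrix.mul_one, Matrix.mul_assoc U, diagonal_mul_diagonal]
          simp [Real.mul_self_sqrt, he]

/-- Characteristic roots, unlike a chosen diagonalization, are invariant under cyclic permutation of
products; this makes the fidelity symmetric and computable after rotation. -/
theorem trace_msqrt {A : Matrix n n ℝ} (hA : A.PosSemidef) :
    (msqrt A).trace = (A.charpoly.roots.map Real.sqrt).sum := by
  rw [hA.isHermitian.roots_charpoly_eq_eigenvalues]
  obtain ⟨U, hU, -, h⟩ := hA.isHermitian.exists_orthogonal_diagonal
  have h2 := msqrt_conj_diagonal hU hA.eigenvalues_nonneg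
  rw [← h] at h2
  rw [h2, trace_mul_cycle, hU, Matrix.one_mul, trace_diagonal]
  simp

/-- The fidelity `tr ((A^{1/2} B A^{1/2})^{1/2})`, expressed through the eigenvalues of `A B`. -/
noncomputable def fidelity (A B : Matrix n n ℝ) : ℝ := ((A * B).charpoly.roots.map Real.sqrt).sum

theorem fidelity_comm (A B : Matrix n n ℝ) : fidelity A B = fidelity B A := by
  rw [fidelity, charpoly_mul_comm, fidelity]

theorem trace_msqrt_conj {A B : Matrix n n ℝ} (hA : A.PosSemidef) (hB : B.PosSemidef) :
    (msqrt (msqrt A * B * msqrt A)).trace = fidelity A B := by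
  rw [trace_msqrt (hB.msqrt_mul_mul_msqrt A), charpoly_mul_comm, ← Matrix.mul_assoc,
    msqrt_mul_self hA, fidelity]

theorem buresSq_eq {A B : Matrix n n ℝ} (hA : A.PosSemidef) (hB : B.PosSemidef) :
    buresSq A B = A.trace + B.trace - 2 * fidelity A B := by
  rw [buresSq, trace_msqrt_conj hA hB]

open Polynomial in
theorem fidelity_eq_of_charpoly {ι : Type*} [Fintype ι] {A B : Matrix n n ℝ} {g : ι → ℝ}
    (h : (A * B).charpoly = ∏ k, (X - C (g k))) : fidelity A B = ∑ k, √(g k) := by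
  have h2 : ∏ k, (X - C (g k)) = ((Finset.univ.val.map g).map fun a => X - C a).prod := by
    rw [Multiset.map_map]
    rfl
  rw [fidelity, h, h2, roots_multiset_prod_X_sub_C]
  simp

end Sqrt

/-! ### Transport map and variational bound for the fidelity -/

section Transport

variable {n : Type*} [Fintype n] [DecidableEq n] {A B X : Matrix n n ℝ}

/-- The optimal transport map from the centred Gaussian law with covariance `B` to the one with
covariance `A`. -/
noncomputable def transportMap (A B : Matrix n n ℝ) : Matrix n n ℝ :=
  (msqrt B)⁻¹ * msqrt (msqrt B * A * msqrt B) * (msqrt B)⁻¹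

theorem msqrt_mul_inv (hB : B.PosDef) : msqrt B * (msqrt B)⁻¹ = 1 :=
  mul_nonsing_inv _ ((isUnit_iff_isUnit_det _).1 (posDef_msqrt hB).isUnit)

theorem inv_mul_msqrt (hB : B.PosDef) : (msqrt B)⁻¹ * msqrt B = 1 :=
  nonsing_inv_mul _ ((isUnit_iff_isUnit_det _).1 (posDef_msqrt hB).isUnit)

theorem posDef_conj_msqrt (hA : A.PosDef) (hB : B.PosDef) :
    (msqrt B * A * msqrt B).PosDef := by
  rw [(hA.posSemidef.msqrt_mul_mul_msqrt B).posDef_iff_isUnit]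
  exact ((posDef_msqrt hB).isUnit.mul hA.isUnit).mul (posDef_msqrt hB).isUnit

theorem posDef_transportMap (hA : A.PosDef) (hB : B.PosDef) : (transportMap A B).PosDef := by
  have h1 : (transportMap A B).PosSemidef := by
    have := (posSemidef_msqrt (msqrt B * A * msqrt B)).mul_mul_transpose (msqrt B)⁻¹
    rwa [transpose_nonsing_inv, transpose_msqrt] at this
  rw [h1.posDef_iff_isUnit]
  exact ((posDef_msqrt hB).inv.isUnit.mul (posDef_msqrt (posDef_conj_msqrt hA hB)).isUnit).mul
    (posDef_msqrt hB).inv.isUnit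

theorem transportMap_mul_mul (hA : A.PosDef) (hB : B.PosDef) :
    transportMap A B * B * transportMap A B = A := by
  have h1 := msqrt_mul_inv hB
  have h2 := inv_mul_msqrt hB
  have h3 := msqrt_mul_self (posDef_conj_msqrt hA hB).posSemidef
  have h4 := msqrt_mul_self hB.posSemidef
  rw [transportMap]
  set L := msqrt B
  set R := msqrt (L * A * L)
  calc _ = L⁻¹ * R * (L⁻¹ * (L * L) * L⁻¹) * R * L⁻¹ := by rw [h4]; simp only [Matrix.mul_assoc]
    _ = L⁻¹ * (R * R) * L⁻¹ := by
        rw [← Matrix.mul_assoc L⁻¹ L L, h2, Matrix.one_mul, h1, Matrix.mul_one]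
        simp only [Matrix.mul_assoc]
    _ = (L⁻¹ * L) * A * (L * L⁻¹) := by rw [h3]; simp only [Matrix.mul_assoc]
    _ = A := by rw [h1, h2, Matrix.one_mul, Matrix.mul_one]

theorem fidelity_eq_trace_mul_transportMap (hA : A.PosDef) (hB : B.PosDef) :
    fidelity A B = (B * transportMap A B).trace := by
  have h1 : B * (msqrt B)⁻¹ = msqrt B := by
    conv_lhs => enter [1]; rw [← msqrt_mul_self hB.posSemidef]
    rw [Matrix.mul_assoc, msqrt_mul_inv hB, Matrix.mul_one]
  rw [fidelity_comm, ← trace_msqrt_conj hB.posSemidef hA.posSemidef, transportMap,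
    ← Matrix.mul_assoc, ← Matrix.mul_assoc, h1, trace_mul_comm, ← Matrix.mul_assoc,
    inv_mul_msqrt hB, Matrix.one_mul]

theorem fidelity_eq_trace_mul_inv (hA : A.PosDef) (hB : B.PosDef) :
    fidelity A B = (A * (transportMap A B)⁻¹).trace := by
  rw [fidelity_eq_trace_mul_transportMap hA hB]
  nth_rw 2 [← transportMap_mul_mul hA hB]
  rw [Matrix.mul_assoc, mul_nonsing_inv _
    ((isUnit_iff_isUnit_det _).1 (posDef_transportMap hA hB).isUnit), Matrix.mul_one,
    trace_mul_comm]

/-- With J the transport map, tr(B(J - X)X⁻¹(J - X)) ≥ 0; expanding with JBJ = A and tr(BJ) = F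
gives the bound. It is sharp at X = J. -/
theorem two_mul_fidelity_le (hA : A.PosDef) (hB : B.PosDef) (hX : X.PosDef) :
    2 * fidelity A B ≤ (A * X⁻¹).trace + (B * X).trace := by
  have hJ := posDef_transportMap hA hB
  have e1 := transportMap_mul_mul hA hB
  have e2 := fidelity_eq_trace_mul_transportMap hA hB
  set J := transportMap A B
  have hs : (J - X)ᵀ = J - X := by
    have h1 := hJ.isHermitian.eq
    have h2 := hX.isHermitian.eq
    simp only [conjTranspose_eq_transpose_of_trivial] at h1 h2
    rw [transpose_sub, h1, h2]
  have h1 : (msqrt B * ((J - X) * X⁻¹ * (J - X)) * msqrt B).PosSemidef := by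
    apply PosSemidef.msqrt_mul_mul_msqrt
    simpa [hs] using hX.inv.posSemidef.mul_mul_transpose (J - X)
  have h2 := h1.trace_nonneg
  rw [trace_mul_comm, ← Matrix.mul_assoc, msqrt_mul_self hB.posSemidef] at h2
  have hu := (isUnit_iff_isUnit_det _).1 hX.isUnit
  have h3 : (J - X) * X⁻¹ * (J - X) = J * X⁻¹ * J - J - J + X := by
    rw [sub_mul, mul_nonsing_inv _ hu, sub_mul, mul_sub, Matrix.one_mul, Matrix.mul_assoc J X⁻¹ X,
      nonsing_inv_mul _ hu, Matrix.mul_one]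
    abel
  rw [h3, mul_add, mul_sub, mul_sub, trace_add, trace_sub, trace_sub] at h2
  have h4 : (B * (J * X⁻¹ * J)).trace = (A * X⁻¹).trace := by
    rw [← e1, ← Matrix.mul_assoc, trace_mul_comm]
    simp only [Matrix.mul_assoc]
  rw [h4] at h2
  linarith

end Transport

/-! ### Continuity of square roots and the derivative of the fidelity -/

section Continuity

variable {n ι : Type*} [Fintype n] [DecidableEq n] {l : Filter ι}

theorem tendsto_matrix_iff {n m ι : Type*} {l : Filter ι} {A : ι → Matrix n m ℝ}
    {B : Matrix n m ℝ} :
    Tendsto A l (𝓝 B) ↔ ∀ i j, Tendsto (fun x => A x i j) l (𝓝 (B i j)) := by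
  refine tendsto_pi_nhds.trans ?_
  simp only [tendsto_pi_nhds]

theorem _root_.Matrix.PosDef.exists_sub_smul_one_posSemidef {A : Matrix n n ℝ} (hA : A.PosDef) :
    ∃ c : ℝ, 0 < c ∧ (A - c • (1 : Matrix n n ℝ)).PosSemidef := by
  obtain ⟨U, -, hU, h⟩ := hA.isHermitian.exists_orthogonal_diagonal
  obtain ⟨c, hc, hle⟩ : ∃ c : ℝ, 0 < c ∧ ∀ i, c ≤ hA.isHermitian.eigenvalues i := by
    cases isEmpty_or_nonempty n
    · exact ⟨1, one_pos, fun i => isEmptyElim i⟩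
    · obtain ⟨i, hi⟩ := Finite.exists_min hA.isHermitian.eigenvalues
      exact ⟨_, hA.eigenvalues_pos i, hi⟩
  refine ⟨c, hc, ?_⟩
  have h1 : A - c • (1 : Matrix n n ℝ) =
      U * diagonal (fun i => hA.isHermitian.eigenvalues i - c) * Uᵀ := by
    rw [← diagonal_sub, mul_sub, sub_mul, ← h, ← smul_one_eq_diagonal, mul_smul_comm,
      smul_mul_assoc, Matrix.mul_one, hU]
  rw [h1]
  exact (PosSemidef.diagonal fun i => sub_nonneg.2 (hle i)).mul_mul_transpose U

theorem trace_mul_transpose_self {n m : Type*} [Fintype n] [Fintype m] (D : Matrix n m ℝ) :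
    (D * Dᵀ).trace = ∑ i, ∑ j, D i j ^ 2 := by
  simp [trace, mul_apply, sq]

theorem eventually_posDef {A : ι → Matrix n n ℝ} {B : Matrix n n ℝ} (hB : B.PosDef)
    (hs : ∀ᶠ x in l, (A x).IsSymm) (hA : Tendsto A l (𝓝 B)) : ∀ᶠ x in l, (A x).PosDef := by
  obtain ⟨c, hc, hBc⟩ := hB.exists_sub_smul_one_posSemidef
  have h0 : Tendsto (fun x => ∑ i, ∑ j, |A x i j - B i j|) l (𝓝 0) := by
    have : Tendsto (fun x => ∑ i, ∑ j, |A x i j - B i j|) l (𝓝 (∑ i : n, ∑ j : n, |B i j - B i j|)) :=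
      tendsto_finsetSum _ fun i _ => tendsto_finsetSum _ fun j _ =>
        ((tendsto_matrix_iff.1 hA i j).sub_const _).abs
    simpa using this
  filter_upwards [hs, h0.eventually (gt_mem_nhds hc)] with x hx hlt
  refine PosDef.of_dotProduct_mulVec_pos
    (by rw [IsHermitian, conjTranspose_eq_transpose_of_trivial]; exact hx) fun v hv => ?_
  have hvv : 0 < v ⬝ᵥ v := by
    have := dotProduct_star_self_pos_iff.2 hv
    simpa using this
  have h1 : v ⬝ᵥ (A x *ᵥ v) = v ⬝ᵥ ((B - c • (1 : Matrix n n ℝ)) *ᵥ v) + c * (v ⬝ᵥ v)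
      + v ⬝ᵥ ((A x - B) *ᵥ v) := by
    simp only [sub_mulVec, dotProduct_sub, smul_mulVec, dotProduct_smul, one_mulVec, smul_eq_mul]
    ring
  have h2 := hBc.dotProduct_mulVec_nonneg v
  have h3 : |v ⬝ᵥ ((A x - B) *ᵥ v)| ≤ (∑ i, ∑ j, |A x i j - B i j|) * (v ⬝ᵥ v) := by
    have hle : ∀ i, v i ^ 2 ≤ v ⬝ᵥ v := fun i => by
      rw [sq]
      exact Finset.single_le_sum (f := fun i => v i * v i) (fun j _ => mul_self_nonneg _)
        (Finset.mem_univ i)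
    have hent : ∀ i j, |v i * ((A x - B) i j * v j)| ≤ |A x i j - B i j| * (v ⬝ᵥ v) := by
      intro i j
      have h5 : |v i| * |v j| ≤ v ⬝ᵥ v := by
        nlinarith [hle i, hle j, sq_nonneg (|v i| - |v j|), sq_abs (v i), sq_abs (v j)]
      rw [abs_mul, abs_mul, Matrix.sub_apply]
      nlinarith [abs_nonneg (A x i j - B i j)]
    have hsum : v ⬝ᵥ ((A x - B) *ᵥ v) = ∑ i, ∑ j, v i * ((A x - B) i j * v j) := by
      simp only [dotProduct, mulVec, Finset.mul_sum]
    simp_rw [hsum, Finset.sum_mul]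
    exact (Finset.abs_sum_le_sum_abs _ _).trans (Finset.sum_le_sum fun i _ =>
      (Finset.abs_sum_le_sum_abs _ _).trans (Finset.sum_le_sum fun j _ => hent i j))
  have h4 := abs_le.1 h3
  simp only [star_trivial] at h2 ⊢
  nlinarith [mul_lt_mul_of_pos_right hlt hvv]

/-- Let R', R be the two roots and D = R' - R. Then C - C₀ = R'D + DR, and pairing with D gives
tr((C - C₀)D) ≥ c tr(D²), where c > 0 bounds R from below. Hence D is at most c⁻¹ times C - C₀ in
Frobenius norm. -/
theorem tendsto_msqrt {C : ι → Matrix n n ℝ} {C₀ : Matrix n n ℝ} (hC₀ : C₀.PosDef)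
    (hC : ∀ᶠ x in l, (C x).PosSemidef) (h : Tendsto C l (𝓝 C₀)) :
    Tendsto (fun x => msqrt (C x)) l (𝓝 (msqrt C₀)) := by
  obtain ⟨c, hc, hR⟩ := (posDef_msqrt hC₀).exists_sub_smul_one_posSemidef
  have h0 : Tendsto (fun x => (∑ i, ∑ j, (C x i j - C₀ i j) ^ 2) / c ^ 2) l (𝓝 0) := by
    have : Tendsto (fun x => ∑ i, ∑ j, (C x i j - C₀ i j) ^ 2) l
        (𝓝 (∑ i : n, ∑ j : n, (C₀ i j - C₀ i j) ^ 2)) :=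
      tendsto_finsetSum _ fun i _ => tendsto_finsetSum _ fun j _ =>
        ((tendsto_matrix_iff.1 h i j).sub_const _).pow 2
    simpa using this.div_const (c ^ 2)
  have key : ∀ x, (C x).PosSemidef → ∑ i, ∑ j, (msqrt (C x) i j - msqrt C₀ i j) ^ 2 ≤
      (∑ i, ∑ j, (C x i j - C₀ i j) ^ 2) / c ^ 2 := by
    intro x hx
    have hE : C x - C₀ = msqrt (C x) * (msqrt (C x) - msqrt C₀) +
        (msqrt (C x) - msqrt C₀) * msqrt C₀ := by
      rw [mul_sub, sub_mul, msqrt_mul_self hx, msqrt_mul_self hC₀.posSemidef]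
      abel
    set D := msqrt (C x) - msqrt C₀ with hD
    have hDt : Dᵀ = D := by rw [hD, transpose_sub, transpose_msqrt, transpose_msqrt]
    have h1 := ((posSemidef_msqrt (C x)).mul_mul_transpose D).trace_nonneg
    have h2 := (hR.mul_mul_transpose D).trace_nonneg
    have h3 : ((C x - C₀) * Dᵀ).trace = (D * msqrt (C x) * Dᵀ).trace
        + (D * (msqrt C₀ - c • (1 : Matrix n n ℝ)) * Dᵀ).trace + c * (D * Dᵀ).trace := by
      have h6 : D * (msqrt C₀ - c • (1 : Matrix n n ℝ)) * Dᵀ =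
          D * msqrt C₀ * Dᵀ - c • (D * Dᵀ) := by
        rw [mul_sub, sub_mul, mul_smul_comm, smul_mul_assoc, Matrix.mul_one]
      rw [hE, h6, trace_sub, trace_smul, add_mul, trace_add, hDt, smul_eq_mul,
        trace_mul_comm (_ * D) D, Matrix.mul_assoc D (msqrt (C x)) D]
      ring
    -- Young's inequality, entry by entry, in place of Cauchy–Schwarz.
    have h4 : 2 * c * ((C x - C₀) * Dᵀ).trace ≤
        ∑ i, ∑ j, (C x i j - C₀ i j) ^ 2 + c ^ 2 * (D * Dᵀ).trace := by
      rw [trace_mul_transpose_self]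
      simp only [trace, mul_apply, diag_apply, transpose_apply, Finset.mul_sum, Matrix.sub_apply,
        ← Finset.sum_add_distrib]
      refine Finset.sum_le_sum fun i _ => Finset.sum_le_sum fun j _ => ?_
      nlinarith [sq_nonneg (C x i j - C₀ i j - c * D i j)]
    have h5 : (D * Dᵀ).trace = ∑ i, ∑ j, (msqrt (C x) i j - msqrt C₀ i j) ^ 2 :=
      trace_mul_transpose_self D
    rw [← h5, le_div_iff₀ (by positivity)]
    nlinarith
  rw [tendsto_matrix_iff]
  intro i j
  rw [tendsto_iff_norm_sub_tendsto_zero]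
  have h6 : Tendsto (fun x => √((∑ i, ∑ j, (C x i j - C₀ i j) ^ 2) / c ^ 2)) l (𝓝 0) := by
    simpa using h0.sqrt
  refine tendsto_of_tendsto_of_tendsto_of_le_of_le' tendsto_const_nhds h6
    (Eventually.of_forall fun x => norm_nonneg _) ?_
  filter_upwards [hC] with x hx
  rw [Real.norm_eq_abs]
  refine Real.abs_le_sqrt (le_trans ?_ (key x hx))
  exact (Finset.single_le_sum (f := fun j => (msqrt (C x) i j - msqrt C₀ i j) ^ 2)
    (fun j _ => sq_nonneg _) (Finset.mem_univ j)).trans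
    (Finset.single_le_sum (f := fun i => ∑ j, (msqrt (C x) i j - msqrt C₀ i j) ^ 2)
    (fun i _ => Finset.sum_nonneg fun j _ => sq_nonneg _) (Finset.mem_univ i))

theorem tendsto_matrix_inv {A : ι → Matrix n n ℝ} {B : Matrix n n ℝ} (hB : B.PosDef)
    (h : Tendsto A l (𝓝 B)) : Tendsto (fun x => (A x)⁻¹) l (𝓝 B⁻¹) := by
  refine (continuousAt_matrix_inv B ?_).tendsto.comp h
  rw [Ring.inverse_eq_inv']
  exact continuousAt_inv₀ hB.det_pos.ne'

theorem tendsto_transportMap {A B : ι → Matrix n n ℝ} {A₀ B₀ : Matrix n n ℝ} (hA₀ : A₀.PosDef)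
    (hB₀ : B₀.PosDef) (hA : ∀ᶠ x in l, (A x).PosSemidef) (hB : ∀ᶠ x in l, (B x).PosSemidef)
    (hA' : Tendsto A l (𝓝 A₀)) (hB' : Tendsto B l (𝓝 B₀)) :
    Tendsto (fun x => transportMap (A x) (B x)) l (𝓝 (transportMap A₀ B₀)) := by
  have h1 := tendsto_msqrt hB₀ hB hB'
  have h2 := tendsto_matrix_inv (posDef_msqrt hB₀) h1
  refine (h2.mul (tendsto_msqrt (posDef_conj_msqrt hA₀ hB₀) ?_ ((h1.mul hA').mul h1))).mul h2
  filter_upwards [hA] with x hx using hx.msqrt_mul_mul_msqrt _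

theorem tendsto_slope_fidelity {A B : Matrix n n ℝ} (hA : A.PosDef) (hB : B.PosDef)
    {Ht Kt : ℝ → Matrix n n ℝ} {H K : Matrix n n ℝ}
    (hHs : ∀ t, 0 < t → (Ht t).IsSymm) (hKs : ∀ t, 0 < t → (Kt t).IsSymm)
    (hH : Tendsto Ht (𝓝[>] 0) (𝓝 H)) (hK : Tendsto Kt (𝓝[>] 0) (𝓝 K)) :
    Tendsto (fun t : ℝ => t⁻¹ * (fidelity (A + t • Ht t) (B + t • Kt t) - fidelity A B)) (𝓝[>] 0)
      (𝓝 (((H * (transportMap A B)⁻¹).trace + (K * transportMap A B).trace) / 2)) := by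
  have ht0 : Tendsto (fun t : ℝ => t) (𝓝[>] 0) (𝓝 0) := tendsto_nhdsWithin_of_tendsto_nhds tendsto_id
  have path : ∀ {M N : Matrix n n ℝ} {Nt : ℝ → Matrix n n ℝ}, M.PosDef →
      (∀ t, 0 < t → (Nt t).IsSymm) → Tendsto Nt (𝓝[>] 0) (𝓝 N) →
      Tendsto (fun t => M + t • Nt t) (𝓝[>] 0) (𝓝 M) ∧
        ∀ᶠ t in 𝓝[>] 0, (M + t • Nt t).PosDef := by
    intro M N Nt hM hs hN
    have h1 : Tendsto (fun t => M + t • Nt t) (𝓝[>] 0) (𝓝 M) := by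
      simpa using (ht0.smul hN).const_add M
    refine ⟨h1, eventually_posDef hM ?_ h1⟩
    filter_upwards [self_mem_nhdsWithin] with t ht
    have hM' : M.IsSymm := by
      have := hM.isHermitian.eq
      rwa [conjTranspose_eq_transpose_of_trivial] at this
    exact hM'.add ((hs t ht).smul t)
  obtain ⟨hA1, hA2⟩ := path hA hHs hH
  obtain ⟨hB1, hB2⟩ := path hB hKs hK
  have hJ := tendsto_transportMap hA hB (hA2.mono fun t h => h.posSemidef)
    (hB2.mono fun t h => h.posSemidef) hA1 hB1
  have hJi := tendsto_matrix_inv (posDef_transportMap hA hB) hJ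
  have htr : Continuous (fun M : Matrix n n ℝ => M.trace) := continuous_id.matrix_trace
  have low := ((((htr.tendsto _).comp (hH.mul hJi)).add
    ((htr.tendsto _).comp (hK.mul hJ))).div_const 2)
  have up := ((((htr.tendsto _).comp (hH.mul_const (transportMap A B)⁻¹)).add
    ((htr.tendsto _).comp (hK.mul_const (transportMap A B)))).div_const 2)
  -- Lower bound: the map at time t is the trial at time 0. Upper bound: the map at time 0 is the
  -- trial at time t.
  refine tendsto_of_tendsto_of_tendsto_of_le_of_le' low up ?_ ?_
  · filter_upwards [self_mem_nhdsWithin, hA2, hB2] with t ht h1 h2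
    have h3 := two_mul_fidelity_le hA hB (posDef_transportMap h1 h2)
    have h4 := fidelity_eq_trace_mul_inv h1 h2
    have h5 := fidelity_eq_trace_mul_transportMap h1 h2
    simp only [Function.comp_def]
    rw [inv_mul_eq_div, le_div_iff₀ ht]
    set J := transportMap (A + t • Ht t) (B + t • Kt t)
    rw [add_mul, trace_add, smul_mul_assoc, trace_smul, smul_eq_mul] at h4 h5
    linarith
  · filter_upwards [self_mem_nhdsWithin, hA2, hB2] with t ht h1 h2
    have h3 := two_mul_fidelity_le h1 h2 (posDef_transportMap hA hB)
    have h4 := fidelity_eq_trace_mul_inv hA hB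
    have h5 := fidelity_eq_trace_mul_transportMap hA hB
    simp only [Function.comp_def]
    rw [inv_mul_eq_div, div_le_iff₀ ht]
    rw [add_mul, trace_add, smul_mul_assoc, trace_smul, smul_eq_mul, add_mul, trace_add,
      smul_mul_assoc, trace_smul, smul_eq_mul] at h3
    linarith

end Continuity

/-! ### Rearrangement and majorization inequalities -/

section Majorization

/-- Abel summation, run as an induction that carries the stronger bound by `μ m` times the partial
sum. -/
theorem sum_mul_nonneg_of_partial_sums_nonneg {μ z : ℕ → ℝ} (hμ : Antitone μ)
    (hμ0 : ∀ i, 0 ≤ μ i) {n : ℕ} (hz : ∀ m ≤ n, 0 ≤ ∑ i ∈ Finset.range m, z i) :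
    0 ≤ ∑ i ∈ Finset.range n, μ i * z i := by
  have key : ∀ m ≤ n, μ m * ∑ i ∈ Finset.range m, z i ≤ ∑ i ∈ Finset.range m, μ i * z i := by
    intro m
    induction m with
    | zero => simp
    | succ m ih =>
      intro hm
      have h1 := ih (by omega)
      have h2 := mul_le_mul_of_nonneg_right (hμ m.le_succ) (hz (m + 1) hm)
      rw [Finset.sum_range_succ] at h2 ⊢
      rw [Finset.sum_range_succ]
      linarith
  exact (mul_nonneg (hμ0 n) (hz n le_rfl)).trans (key n le_rfl)

theorem pad_coe {n : ℕ} (l : Fin n → ℝ) (i : Fin n) : pad l i = l i := by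
  simp [pad]

theorem pad_of_le {n : ℕ} (l : Fin n → ℝ) {k : ℕ} (h : n ≤ k) : pad l k = 0 := by
  simp [pad, h]

theorem pad_nonneg {n : ℕ} {l : Fin n → ℝ} (hl : ∀ i, 0 ≤ l i) (k : ℕ) : 0 ≤ pad l k := by
  unfold pad
  split_ifs
  exacts [hl _, le_rfl]

theorem antitone_pad {n : ℕ} {l : Fin n → ℝ} (hl : ∀ i, 0 ≤ l i) (h : Antitone l) :
    Antitone (pad l) := by
  intro a b hab
  rcases lt_or_ge b n with hb | hb
  · rw [pad, dif_pos hb, pad, dif_pos (hab.trans_lt hb)]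
    exact h (by simpa using hab)
  · rw [pad_of_le l hb]
    exact pad_nonneg hl a

theorem sum_eq_sum_castLE {n d : ℕ} (h : n ≤ d) {f : Fin d → ℝ}
    (hf : ∀ k : Fin d, n ≤ (k : ℕ) → f k = 0) : ∑ k, f k = ∑ i : Fin n, f (i.castLE h) := by
  refine (Fintype.sum_of_injective (Fin.castLE h) (Fin.castLE_injective h) _ _ ?_
    fun i => rfl).symm
  intro k hk
  refine hf k (not_lt.1 fun hlt => hk ⟨⟨k, hlt⟩, by ext; simp⟩)

/-- Pairing the largest weights with the smallest values is optimal. By Abel summation it suffices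
to treat the first m rows with unit weight: their column sums lie in [0,1] and total m, so they
cannot beat the indicator of the m smallest values. -/
theorem sum_pad_mul_le {n d : ℕ} (hnd : n ≤ d) {μ : Fin n → ℝ} (hμ : Antitone μ)
    (hμ0 : ∀ i, 0 ≤ μ i) {a : Fin n → Fin d → ℝ} (ha : ∀ i k, 0 ≤ a i k)
    (hrow : ∀ i, ∑ k, a i k = 1) (hcol : ∀ k, ∑ i, a i k ≤ 1) {x : Fin d → ℝ} (hx : Monotone x) :
    ∑ k : Fin d, pad μ k * x k ≤ ∑ k, (∑ i, μ i * a i k) * x k := by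
  set z : Fin n → ℝ := fun i => ∑ k, a i k * x k - x (i.castLE hnd) with hz
  have h1 : 0 ≤ ∑ i ∈ Finset.range n, pad μ i * pad z i := by
    refine sum_mul_nonneg_of_partial_sums_nonneg (antitone_pad hμ0 hμ) (pad_nonneg hμ0) ?_
    intro m hm
    rcases Nat.eq_zero_or_pos m with rfl | hm0
    · simp
    set s : Fin d → ℝ := fun k => ∑ i : Fin m, a (i.castLE hm) k
    set e : Fin d → ℝ := fun k => if (k : ℕ) < m then 1 else 0
    have hs1 : ∀ k, s k ≤ 1 := fun k => by
      refine le_trans ?_ (hcol k)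
      have := sum_eq_sum_castLE hm (f := fun i => if (i : ℕ) < m then a i k else 0)
        (fun i hi => if_neg (not_lt.2 hi))
      simp only [Fin.val_castLE, Fin.is_lt, if_true] at this
      rw [show s k = _ from this.symm]
      refine Finset.sum_le_sum fun i _ => ?_
      split_ifs
      exacts [le_rfl, ha i k]
    have hs0 : ∀ k, 0 ≤ s k := fun k => Finset.sum_nonneg fun i _ => ha _ k
    have hes : ∀ f : Fin d → ℝ, ∑ k, e k * f k = ∑ i : Fin m, f (i.castLE (hm.trans hnd)) := by
      intro f
      rw [sum_eq_sum_castLE (hm.trans hnd) (f := fun k => e k * f k)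
        (fun k hk => by simp [e, not_lt.2 hk])]
      simp [e]
    have hsum : ∑ k, s k = m := by
      rw [Finset.sum_comm]
      simp [hrow]
    have hesum : ∑ k, e k = m := by simpa using hes 1
    have hzsum : ∑ i ∈ Finset.range m, pad z i = ∑ k, (s k - e k) * x k := by
      rw [← Fin.sum_univ_eq_sum_range]
      simp_rw [sub_mul, Finset.sum_sub_distrib, hes, s, Finset.sum_mul]
      rw [Finset.sum_comm, ← Finset.sum_sub_distrib]
      refine Finset.sum_congr rfl fun i _ => ?_
      rw [show (i : ℕ) = (i.castLE hm : Fin n) from rfl, pad_coe]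
      rfl
    -- Both weights total m, so a constant may be subtracted from x. With the m-th smallest value as
    -- threshold every term is nonnegative; index m itself could be out of range.
    set τ := x ⟨m - 1, by omega⟩
    have h2 : ∑ k, (s k - e k) * x k = ∑ k, (s k - e k) * (x k - τ) := by
      simp_rw [mul_sub, Finset.sum_sub_distrib, ← Finset.sum_mul, Finset.sum_sub_distrib, hsum,
        hesum]
      ring
    rw [hzsum, h2]
    refine Finset.sum_nonneg fun k _ => ?_
    by_cases hk : (k : ℕ) < m
    · have h3 : x k ≤ τ := hx (by rw [Fin.le_def]; simp; omega)
      simp only [e, hk, if_true]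
      nlinarith [hs1 k]
    · have h3 : τ ≤ x k := hx (by rw [Fin.le_def]; simp; omega)
      simp only [e, hk, if_false]
      nlinarith [hs0 k]
  rw [← Fin.sum_univ_eq_sum_range (fun i => pad μ i * pad z i)] at h1
  simp only [pad_coe, hz, mul_sub, Finset.sum_sub_distrib] at h1
  rw [sum_eq_sum_castLE hnd (fun k hk => by rw [pad_of_le μ hk, zero_mul])]
  simp_rw [Finset.sum_mul]
  rw [Finset.sum_comm]
  simp only [Fin.val_castLE, pad_coe]
  simp_rw [mul_assoc, ← Finset.mul_sum]
  linarith

/-- P = BᵀB is an orthogonal projection, so Pₖₖ = ∑ⱼ Pₖⱼ² ≥ Pₖₖ². -/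
theorem sum_sq_col_le_one {n m : Type*} [Fintype n] [Fintype m] [DecidableEq n]
    {B : Matrix n m ℝ} (hB : B * Bᵀ = 1) (k : m) : ∑ i, B i k ^ 2 ≤ 1 := by
  have h1 : (Bᵀ * B) * (Bᵀ * B)ᵀ = Bᵀ * B := by
    rw [transpose_mul, transpose_transpose, Matrix.mul_assoc, ← Matrix.mul_assoc B, hB,
      Matrix.one_mul]
  have h2 : (Bᵀ * B) k k = ∑ j, (Bᵀ * B) k j ^ 2 := by
    have := congrFun (congrFun h1 k) k
    rw [mul_apply] at this
    simp only [transpose_apply, ← sq] at this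
    exact this.symm
  have h3 : (Bᵀ * B) k k = ∑ i, B i k ^ 2 := by simp [mul_apply, sq]
  have h4 : (Bᵀ * B) k k ^ 2 ≤ ∑ j, (Bᵀ * B) k j ^ 2 :=
    Finset.single_le_sum (f := fun j => (Bᵀ * B) k j ^ 2) (fun j _ => sq_nonneg _)
      (Finset.mem_univ k)
  rw [← h2] at h4
  rw [← h3]
  nlinarith

/-- The concave square root lies below its tangent at c. The shift ε keeps the slope finite where c
vanishes and is sent to 0 at the end. -/
theorem sum_sqrt_le_of_sum_mul_le {ι : Type*} [Fintype ι] {g c : ι → ℝ} (hg : ∀ k, 0 ≤ g k)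
    (hc : ∀ k, 0 ≤ c k)
    (h : ∀ ε > 0, ∑ k, g k * (√(c k + ε))⁻¹ ≤ ∑ k, c k * (√(c k + ε))⁻¹) :
    ∑ k, √(g k) ≤ ∑ k, √(c k) := by
  have key : ∀ ε > 0, ∑ k, √(g k + ε) ≤ ∑ k, √(c k + ε) := by
    intro ε hε
    have h1 : ∀ k, √(g k + ε) ≤ ((g k + ε) * (√(c k + ε))⁻¹ + √(c k + ε)) / 2 := by
      intro k
      have h2 : 0 < √(c k + ε) := Real.sqrt_pos.2 (by linarith [hc k])
      have h3 : √(g k + ε) ^ 2 = g k + ε := Real.sq_sqrt (by linarith [hg k])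
      suffices √(g k + ε) ≤ (√(g k + ε) ^ 2 * (√(c k + ε))⁻¹ + √(c k + ε)) / 2 by rwa [h3] at this
      rw [← div_eq_mul_inv, div_add' _ _ _ h2.ne', div_div, le_div_iff₀ (by positivity)]
      nlinarith [sq_nonneg (√(g k + ε) - √(c k + ε))]
    have h4 : ∀ k, √(c k + ε) = (c k + ε) * (√(c k + ε))⁻¹ := by
      intro k
      have h2 : 0 < √(c k + ε) := Real.sqrt_pos.2 (by linarith [hc k])
      have h3 : √(c k + ε) ^ 2 = c k + ε := Real.sq_sqrt (by linarith [hc k])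
      rw [eq_mul_inv_iff_mul_eq₀ h2.ne', ← h3, sq, Real.sqrt_mul_self h2.le]
    have h5 := Finset.sum_le_sum fun k (_ : k ∈ Finset.univ) => h1 k
    have h6 := Finset.sum_congr rfl fun k (_ : k ∈ Finset.univ) => h4 k
    have h7 := h ε hε
    simp only [← Finset.sum_div, add_mul, Finset.sum_add_distrib] at h5 h6
    linarith
  have lim : ∀ f : ι → ℝ, Tendsto (fun ε : ℝ => ∑ k, √(f k + ε)) (𝓝[>] 0) (𝓝 (∑ k, √(f k))) := by
    intro f
    have h1 : Continuous (fun ε : ℝ => ∑ k, √(f k + ε)) := by fun_prop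
    simpa using (h1.tendsto 0).mono_left nhdsWithin_le_nhds
  exact le_of_tendsto_of_tendsto (lim g) (lim c)
    (by filter_upwards [self_mem_nhdsWithin] with ε hε using key ε hε)

/-- Here c and the rows of N play the role of eigenvalues and unit eigenvectors of a matrix with
diagonal blocks diag(l₁²), diag(l₂²). The tangent slopes (c + ε)^{-1/2} increase with k, so the
rearrangement bound applies to each block; the two bounds add up because the rows of N are unit
vectors. -/
theorem sum_sqrt_le_of_diagonal_blocks {p q d : ℕ} (hp : p ≤ d) (hq : q ≤ d) {l₁ : Fin p → ℝ}
    {l₂ : Fin q → ℝ} (h₁ : Antitone l₁) (h₂ : Antitone l₂) (hl₁ : ∀ i, 0 < l₁ i)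
    (hl₂ : ∀ i, 0 < l₂ i) {c : Fin d → ℝ} (hc : Antitone c) (hc0 : ∀ k, 0 ≤ c k)
    {N : Matrix (Fin d) (Fin p ⊕ Fin q) ℝ} (hN : ∀ k, ∑ s, N k s ^ 2 = 1)
    (hN₁ : ∀ i i', ∑ k, c k * N k (.inl i) * N k (.inl i') = if i = i' then l₁ i ^ 2 else 0)
    (hN₂ : ∀ i i', ∑ k, c k * N k (.inr i) * N k (.inr i') = if i = i' then l₂ i ^ 2 else 0) :
    ∑ k : Fin d, √(pad l₁ k ^ 2 + pad l₂ k ^ 2) ≤ ∑ k, √(c k) := by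
  refine sum_sqrt_le_of_sum_mul_le (fun k => by positivity) hc0 fun ε hε => ?_
  set x : Fin d → ℝ := fun k => (√(c k + ε))⁻¹
  have hx : Monotone x := fun k k' hk => by
    have : 0 < √(c k' + ε) := Real.sqrt_pos.2 (by linarith [hc0 k'])
    exact inv_anti₀ this (Real.sqrt_le_sqrt (by linarith [hc hk]))
  have bound : ∀ {n : ℕ} (_ : n ≤ d) {l : Fin n → ℝ} (_ : Antitone l) (_ : ∀ i, 0 < l i)
      {M : Matrix (Fin d) (Fin n) ℝ}
      (_ : ∀ i i', ∑ k, c k * M k i * M k i' = if i = i' then l i ^ 2 else 0),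
      ∑ k : Fin d, pad l k ^ 2 * x k ≤ ∑ k, (∑ i, c k * M k i ^ 2) * x k := by
    intro n hn l hla hl M hM
    -- Normalized so that the rows are orthonormal; the squared entries are then the weights
    -- required by `sum_pad_mul_le`.
    set B : Matrix (Fin n) (Fin d) ℝ := Matrix.of fun i k => √(c k) * M k i / l i
    have hB2 : ∀ i k, B i k ^ 2 = c k * M k i ^ 2 / l i ^ 2 := fun i k => by
      simp only [B, of_apply]
      rw [div_pow, mul_pow, Real.sq_sqrt (hc0 k)]
    have hBB : B * Bᵀ = 1 := by
      ext i i'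
      have h3 : ∀ k, B i k * B i' k = (c k * M k i * M k i') / (l i * l i') := fun k => by
        simp only [B, of_apply]
        rw [div_mul_div_comm, mul_mul_mul_comm, Real.mul_self_sqrt (hc0 k), mul_assoc]
      simp only [mul_apply, transpose_apply, h3]
      rw [← Finset.sum_div, hM, one_apply]
      split_ifs with h
      · subst h
        have := (hl i).ne'
        field_simp
      · simp
    have h4 := sum_pad_mul_le hn (μ := fun i => l i ^ 2)
      (fun i j hij => pow_le_pow_left₀ (hl j).le (hla hij) 2) (fun i => by positivity)
      (a := fun i k => B i k ^ 2) (fun i k => sq_nonneg _)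
      (fun i => by
        have := congrFun (congrFun hBB i) i
        simpa [mul_apply, sq] using this)
      (sum_sq_col_le_one hBB) hx
    have h5 : ∀ k : Fin d, pad (fun i => l i ^ 2) k = pad l k ^ 2 := fun k => by
      unfold pad
      split_ifs <;> simp
    have h6 : ∀ i k, l i ^ 2 * B i k ^ 2 = c k * M k i ^ 2 := fun i k => by
      have := (hl i).ne'
      rw [hB2]
      field_simp
    simpa only [h5, h6] using h4
  have b1 := bound hp h₁ hl₁ (M := Matrix.of fun k i => N k (.inl i)) hN₁
  have b2 := bound hq h₂ hl₂ (M := Matrix.of fun k i => N k (.inr i)) hN₂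
  calc _ = ∑ k : Fin d, pad l₁ k ^ 2 * x k + ∑ k : Fin d, pad l₂ k ^ 2 * x k := by
        simp only [add_mul, Finset.sum_add_distrib, x]
    _ ≤ _ := add_le_add b1 b2
    _ = _ := by
        rw [← Finset.sum_add_distrib]
        refine Finset.sum_congr rfl fun k _ => ?_
        have := hN k
        rw [Fintype.sum_sum_type] at this
        simp only [of_apply, ← Finset.mul_sum, ← add_mul, ← mul_add, this, mul_one, x]

end Majorization

/-! ### Ordered eigendecompositions -/

namespace IsEigendecomposition

variable {n : ℕ} {A U : Matrix (Fin n) (Fin n) ℝ} {l : Fin n → ℝ}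

theorem mul_transpose (h : IsEigendecomposition A U l) : U * Uᵀ = 1 := by
  exact (mem_orthogonalGroup_iff _ _).1 h.orthogonal

theorem transpose_mul (h : IsEigendecomposition A U l) : Uᵀ * U = 1 :=
  mul_eq_one_comm.1 h.mul_transpose

theorem transpose_mul_mul (h : IsEigendecomposition A U l) : Uᵀ * A * U = diagonal l := by
  calc Uᵀ * A * U = (Uᵀ * U) * diagonal l * (Uᵀ * U) := by
        rw [h.eq]; simp only [Matrix.mul_assoc]
    _ = diagonal l := by rw [h.transpose_mul, Matrix.one_mul, Matrix.mul_one]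

theorem pos (h : IsEigendecomposition A U l) (hA : A.PosDef) (i : Fin n) : 0 < l i := by
  have h1 : (diagonal l).PosDef := by
    rw [← h.transpose_mul_mul]
    have h2 := hA.posSemidef.transpose_mul_mul U
    rw [h2.posDef_iff_isUnit]
    have hU : IsUnit U := IsUnit.of_mul_eq_one _ h.mul_transpose
    have hU' : IsUnit Uᵀ := IsUnit.of_mul_eq_one _ h.transpose_mul
    exact (hU'.mul hA.isUnit).mul hU
  exact posDef_diagonal_iff.1 h1 i

theorem trace_eq (h : IsEigendecomposition A U l) : A.trace = ∑ i, l i := by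
  rw [h.eq, trace_mul_cycle, h.transpose_mul, Matrix.one_mul, trace_diagonal]

end IsEigendecomposition

theorem exists_equiv_antitone {ι : Type*} [Fintype ι] {n : ℕ} (h : Fintype.card ι = n)
    (e : ι → ℝ) : ∃ σ : Fin n ≃ ι, Antitone (e ∘ σ) := by
  let τ := (Fintype.equivFinOfCardEq h).symm
  refine ⟨(Tuple.sort fun i => -e (τ i)).trans τ, fun i j hij => ?_⟩
  have := Tuple.monotone_sort (fun i => -e (τ i)) hij
  simpa using this

theorem exists_isEigendecomposition {n : ℕ} {A : Matrix (Fin n) (Fin n) ℝ} (hA : A.IsHermitian) :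
    ∃ U l, IsEigendecomposition A U l := by
  obtain ⟨V, h1, h2, h3⟩ := hA.exists_orthogonal_diagonal
  obtain ⟨σ, hσ⟩ := exists_equiv_antitone (Fintype.card_fin n) hA.eigenvalues
  refine ⟨V.submatrix id σ, hA.eigenvalues ∘ σ, ?_, hσ, ?_⟩
  · rw [mem_orthogonalGroup_iff, transpose_submatrix, submatrix_mul_equiv, h2, submatrix_id_id]
  · rw [← submatrix_diagonal_equiv, submatrix_mul_equiv, transpose_submatrix, submatrix_mul_equiv,
      ← h3, submatrix_id_id]

/-- `∑ₖ (λ_{k,1}² + λ_{k,2}²)^{1/2}`, the least fidelity between `S₀` and a coupling. -/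
noncomputable def minFidelity {p q : ℕ} (l₁ : Fin p → ℝ) (l₂ : Fin q → ℝ) : ℝ :=
  ∑ k : Fin (p + q), √(pad l₁ k ^ 2 + pad l₂ k ^ 2)

/-! ### The extremal coupling and a closed form for D₂ -/

section Couplings

variable {p q : ℕ} {S T : Matrix (Fin p ⊕ Fin q) (Fin p ⊕ Fin q) ℝ}
  {U₁ : Matrix (Fin p) (Fin p) ℝ} {l₁ : Fin p → ℝ} {U₂ : Matrix (Fin q) (Fin q) ℝ}
  {l₂ : Fin q → ℝ}

theorem posDef_toBlocks₁₁ (hS : S.PosDef) : S.toBlocks₁₁.PosDef :=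
  hS.submatrix Sum.inl_injective

theorem posDef_toBlocks₂₂ (hS : S.PosDef) : S.toBlocks₂₂.PosDef :=
  hS.submatrix Sum.inr_injective

theorem trace_eq_add (S : Matrix (Fin p ⊕ Fin q) (Fin p ⊕ Fin q) ℝ) :
    S.trace = S.toBlocks₁₁.trace + S.toBlocks₂₂.trace := by
  simp [trace, toBlocks₁₁, toBlocks₂₂]

theorem trace_blockPart (S : Matrix (Fin p ⊕ Fin q) (Fin p ⊕ Fin q) ℝ) :
    (blockPart S).trace = S.trace := by
  rw [trace_eq_add S, trace_eq_add]
  rfl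

theorem blockPart_eq (h₁ : IsEigendecomposition S.toBlocks₁₁ U₁ l₁)
    (h₂ : IsEigendecomposition S.toBlocks₂₂ U₂ l₂) :
    blockPart S = fromBlocks U₁ 0 0 U₂ * diagonal (Sum.elim l₁ l₂) * (fromBlocks U₁ 0 0 U₂)ᵀ := by
  rw [blockPart, ← fromBlocks_diagonal, fromBlocks_transpose, fromBlocks_multiply,
    fromBlocks_multiply]
  simp [← h₁.eq, ← h₂.eq]

theorem transpose_mul_fromBlocks (h₁ : U₁ᵀ * U₁ = 1) (h₂ : U₂ᵀ * U₂ = 1) :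
    (fromBlocks U₁ 0 0 U₂)ᵀ * fromBlocks U₁ 0 0 U₂ = 1 := by
  simp [fromBlocks_transpose, fromBlocks_multiply, h₁, h₂]

theorem posDef_blockPart (hS : S.PosDef) : (blockPart S).PosDef := by
  obtain ⟨U₁, l₁, h₁⟩ := exists_isEigendecomposition (posDef_toBlocks₁₁ hS).isHermitian
  obtain ⟨U₂, l₂, h₂⟩ := exists_isEigendecomposition (posDef_toBlocks₂₂ hS).isHermitian
  have hU := transpose_mul_fromBlocks h₁.transpose_mul h₂.transpose_mul
  have hd : (diagonal (Sum.elim l₁ l₂)).PosDef := by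
    refine PosDef.diagonal fun i => ?_
    rcases i with i | i
    exacts [h₁.pos (posDef_toBlocks₁₁ hS) i, h₂.pos (posDef_toBlocks₂₂ hS) i]
  rw [blockPart_eq h₁ h₂, (hd.posSemidef.mul_mul_transpose _).posDef_iff_isUnit]
  exact ((IsUnit.of_mul_eq_one _ (mul_eq_one_comm.1 hU)).mul hd.isUnit).mul
    (IsUnit.of_mul_eq_one _ hU)

theorem minFidelity_le (hT : T.PosSemidef) (h₁ : IsEigendecomposition T.toBlocks₁₁ U₁ l₁)
    (h₂ : IsEigendecomposition T.toBlocks₂₂ U₂ l₂) (hl₁ : ∀ i, 0 < l₁ i) (hl₂ : ∀ i, 0 < l₂ i) :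
    minFidelity l₁ l₂ ≤ fidelity T (blockPart T) := by
  set W := fromBlocks U₁ 0 0 U₂
  set L := diagonal (fun s => √(Sum.elim l₁ l₂ s))
  have hL : L * L = diagonal (Sum.elim l₁ l₂) := by
    rw [diagonal_mul_diagonal]
    congr 1
    ext s
    refine Real.mul_self_sqrt ?_
    rcases s with s | s
    exacts [(hl₁ s).le, (hl₂ s).le]
  -- Has the spectrum of T T₀. In the rotated basis the diagonal blocks of T are diag(l₁) and
  -- diag(l₂), so those of C are diag(l₁²) and diag(l₂²).
  set C := L * (Wᵀ * T * W) * L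
  have hC : C.PosSemidef := by
    have := (hT.transpose_mul_mul W).mul_mul_transpose L
    rwa [show Lᵀ = L from diagonal_transpose _] at this
  have hchar : (T * blockPart T).charpoly = C.charpoly := by
    rw [blockPart_eq h₁ h₂, ← hL]
    calc (T * (W * (L * L) * Wᵀ)).charpoly = ((T * W * L) * (L * Wᵀ)).charpoly := by
          simp only [Matrix.mul_assoc]
      _ = _ := by rw [charpoly_mul_comm]; simp only [C, Matrix.mul_assoc]
  rw [fidelity_eq_of_charpoly (hchar.trans hC.isHermitian.charpoly_eq)]
  obtain ⟨V, hV, -, hCV⟩ := hC.isHermitian.exists_orthogonal_diagonal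
  set e := hC.isHermitian.eigenvalues
  obtain ⟨σ, hσ⟩ := exists_equiv_antitone (n := p + q) (by simp) e
  have hCe : ∀ s s', ∑ k, e (σ k) * V s (σ k) * V s' (σ k) = C s s' := by
    intro s s'
    rw [hCV, mul_apply]
    simp only [mul_diagonal, transpose_apply]
    rw [Equiv.sum_comp σ (fun k => e k * V s k * V s' k)]
    exact Finset.sum_congr rfl fun k _ => by ring
  have hWTW : ∀ {n : ℕ} {B U : Matrix (Fin n) (Fin n) ℝ} {l : Fin n → ℝ},
      IsEigendecomposition B U l → (∀ i, 0 < l i) → ∀ i i',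
      √(l i) * (Uᵀ * B * U) i i' * √(l i') = if i = i' then l i ^ 2 else 0 := by
    intro n B U l h hl i i'
    rw [h.transpose_mul_mul, diagonal_apply]
    split_ifs with hi
    · subst hi
      rw [mul_right_comm, Real.mul_self_sqrt (hl i).le, sq]
    · simp
  have hblock : Wᵀ * T * W = fromBlocks (U₁ᵀ * T.toBlocks₁₁ * U₁) (U₁ᵀ * T.toBlocks₁₂ * U₂)
      (U₂ᵀ * T.toBlocks₂₁ * U₁) (U₂ᵀ * T.toBlocks₂₂ * U₂) := by
    conv_lhs => rw [← fromBlocks_toBlocks T]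
    simp [W, fromBlocks_transpose, fromBlocks_multiply]
  have := sum_sqrt_le_of_diagonal_blocks (Nat.le_add_right p q) (Nat.le_add_left q p) h₁.ordered
    h₂.ordered hl₁ hl₂ (c := e ∘ σ) hσ (fun k => hC.eigenvalues_nonneg _)
    (N := Matrix.of fun k s => V s (σ k))
    (fun k => by
      have := congrFun (congrFun hV (σ k)) (σ k)
      simpa [mul_apply, sq] using this)
    (fun i i' => by
      rw [← hWTW h₁ hl₁ i i']
      simp only [of_apply, Function.comp_apply, hCe, C, L, diagonal_mul, mul_diagonal, hblock,
        fromBlocks_apply₁₁, Sum.elim_inl])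
    (fun i i' => by
      rw [← hWTW h₂ hl₂ i i']
      simp only [of_apply, Function.comp_apply, hCe, C, L, diagonal_mul, mul_diagonal, hblock,
        fromBlocks_apply₂₂, Sum.elim_inr])
  refine this.trans_eq ?_
  exact Equiv.sum_comp σ (fun k => √(e k))

/-- The `(p + q) × (p + q)` matrix `[diag a; diag b]` with rectangular diagonal blocks. -/
def stackedDiagonal (a : Fin p → ℝ) (b : Fin q → ℝ) : Matrix (Fin (p + q)) (Fin p ⊕ Fin q) ℝ :=
  Matrix.of fun k s => Sum.elim (fun i : Fin p => if (i : ℕ) = (k : ℕ) then a i else 0)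
    (fun j : Fin q => if (j : ℕ) = (k : ℕ) then b j else 0) s

theorem sum_fin_ite_eq {n d : ℕ} (h : n ≤ d) (i : Fin n) (c : Fin d → ℝ) :
    ∑ k : Fin d, (if (i : ℕ) = (k : ℕ) then c k else 0) = c (i.castLE h) := by
  have : ∀ k : Fin d, ((i : ℕ) = (k : ℕ)) ↔ (i.castLE h = k) := fun k => by
    rw [Fin.ext_iff]; simp
  simp [this]

theorem sum_fin_ite_eq_pad {n : ℕ} (k : ℕ) (c : Fin n → ℝ) :
    ∑ i : Fin n, (if (i : ℕ) = k then c i else 0) = pad c k := by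
  unfold pad
  split_ifs with h
  · have : ∀ i : Fin n, ((i : ℕ) = k) ↔ (i = ⟨k, h⟩) := fun i => by rw [Fin.ext_iff]
    simp [this]
  · exact Finset.sum_eq_zero fun i _ => if_neg (by omega)

theorem stackedDiagonal_transpose_mul (a : Fin p → ℝ) (b : Fin q → ℝ) :
    (stackedDiagonal a b)ᵀ * stackedDiagonal a b =
      fromBlocks (diagonal fun i => a i ^ 2)
        (diagonal a *
          (Matrix.of fun (i : Fin p) (j : Fin q) => if (i : ℕ) = (j : ℕ) then (1 : ℝ) else 0) *
          diagonal b)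
        (diagonal a *
          (Matrix.of fun (i : Fin p) (j : Fin q) => if (i : ℕ) = (j : ℕ) then (1 : ℝ) else 0) *
          diagonal b)ᵀ
        (diagonal fun j => b j ^ 2) := by
  have hp : p ≤ p + q := Nat.le_add_right p q
  have hq : q ≤ p + q := Nat.le_add_left q p
  have hX : ∀ i j, (diagonal a *
      (Matrix.of fun (i : Fin p) (j : Fin q) => if (i : ℕ) = (j : ℕ) then (1 : ℝ) else 0) *
      diagonal b) i j = a i * (if (i : ℕ) = (j : ℕ) then 1 else 0) * b j := fun i j => by
    rw [mul_diagonal, diagonal_mul, of_apply]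
  ext s s'
  rcases s with i | i <;> rcases s' with j | j
  · simp only [mul_apply, stackedDiagonal, transpose_apply, of_apply, Sum.elim_inl, ite_mul,
      zero_mul, fromBlocks_apply₁₁]
    rw [sum_fin_ite_eq hp i (fun k => a i * if (j : ℕ) = (k : ℕ) then a j else 0), diagonal_apply]
    by_cases h : i = j
    · subst h; simp [sq]
    · have : ¬ (j : ℕ) = i := fun h' => h (Fin.ext h'.symm)
      simp [h, this]
  · rw [fromBlocks_apply₁₂, hX, mul_apply]
    simp only [stackedDiagonal, transpose_apply, of_apply, Sum.elim_inl, Sum.elim_inr,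
      ite_mul, zero_mul]
    rw [sum_fin_ite_eq hp i (fun k => a i * if (j : ℕ) = (k : ℕ) then b j else 0)]
    by_cases h : (i : ℕ) = j <;> simp [h, eq_comm]
  · rw [fromBlocks_apply₂₁, transpose_apply, hX, mul_apply]
    simp only [stackedDiagonal, transpose_apply, of_apply, Sum.elim_inl, Sum.elim_inr,
      ite_mul, zero_mul]
    rw [sum_fin_ite_eq hq i (fun k => b i * if (j : ℕ) = (k : ℕ) then a j else 0)]
    by_cases h : (i : ℕ) = j <;> simp [h, eq_comm, mul_comm]
  · simp only [mul_apply, stackedDiagonal, transpose_apply, of_apply, Sum.elim_inr, ite_mul,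
      zero_mul, fromBlocks_apply₂₂]
    rw [sum_fin_ite_eq hq i (fun k => b i * if (j : ℕ) = (k : ℕ) then b j else 0), diagonal_apply]
    by_cases h : i = j
    · subst h; simp [sq]
    · have : ¬ (j : ℕ) = i := fun h' => h (Fin.ext h'.symm)
      simp [h, this]

theorem stackedDiagonal_mul_mul_transpose (a : Fin p → ℝ) (b : Fin q → ℝ) (c : Fin p → ℝ)
    (d : Fin q → ℝ) :
    stackedDiagonal a b * diagonal (Sum.elim c d) * (stackedDiagonal a b)ᵀ =
      diagonal fun k : Fin (p + q) =>
        pad (fun i => a i ^ 2 * c i) k + pad (fun j => b j ^ 2 * d j) k := by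
  ext k k'
  rw [mul_apply, Fintype.sum_sum_type, diagonal_apply]
  simp only [mul_diagonal, stackedDiagonal, transpose_apply, of_apply, Sum.elim_inl, Sum.elim_inr,
    ite_mul, zero_mul]
  rw [sum_fin_ite_eq_pad (k : ℕ) (fun i : Fin p => a i * c i * if (i : ℕ) = (k' : ℕ) then a i else 0),
    sum_fin_ite_eq_pad (k : ℕ) (fun i : Fin q => b i * d i * if (i : ℕ) = (k' : ℕ) then b i else 0)]
  unfold pad
  by_cases h : k = k'
  · subst h
    simp only [if_true]
    congr 1 <;> split_ifs <;> first | rfl | ring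
  · have h' : ¬ (k : ℕ) = k' := fun h' => h (Fin.ext h')
    simp [h, h']

/-- This Gram form yields positive semi-definiteness, and lets the factors be cycled when computing
the fidelity. -/
theorem maxCoupling_eq (h₁ : IsEigendecomposition S.toBlocks₁₁ U₁ l₁)
    (h₂ : IsEigendecomposition S.toBlocks₂₂ U₂ l₂) (hl₁ : ∀ i, 0 ≤ l₁ i) (hl₂ : ∀ i, 0 ≤ l₂ i) :
    maxCoupling S U₁ l₁ U₂ l₂ = fromBlocks U₁ 0 0 U₂ *
      ((stackedDiagonal (fun i => √(l₁ i)) (fun j => √(l₂ j)))ᵀ *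
        stackedDiagonal (fun i => √(l₁ i)) (fun j => √(l₂ j))) * (fromBlocks U₁ 0 0 U₂)ᵀ := by
  rw [stackedDiagonal_transpose_mul, maxCoupling, fromBlocks_transpose, fromBlocks_multiply,
    fromBlocks_multiply]
  simp only [Real.sq_sqrt (hl₁ _), Real.sq_sqrt (hl₂ _), Matrix.mul_zero, Matrix.zero_mul,
    add_zero, zero_add, transpose_zero, ← h₁.eq, ← h₂.eq]
  congr 1
  · simp only [maxCross, Matrix.mul_assoc]
  · simp only [maxCross, Matrix.mul_assoc, transpose_mul, transpose_transpose]

theorem posSemidef_maxCoupling (h₁ : IsEigendecomposition S.toBlocks₁₁ U₁ l₁)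
    (h₂ : IsEigendecomposition S.toBlocks₂₂ U₂ l₂) (hl₁ : ∀ i, 0 ≤ l₁ i) (hl₂ : ∀ i, 0 ≤ l₂ i) :
    (maxCoupling S U₁ l₁ U₂ l₂).PosSemidef := by
  rw [maxCoupling_eq h₁ h₂ hl₁ hl₂]
  refine PosSemidef.mul_mul_transpose ?_ _
  simpa [conjTranspose_eq_transpose_of_trivial] using posSemidef_conjTranspose_mul_self
    (stackedDiagonal (fun i => √(l₁ i)) (fun j => √(l₂ j)))

-- With the Gram factor F and D = diag(l₁, l₂), the product has the spectrum of FᵀFD, hence of FDFᵀ,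
-- which is diagonal with entries λ_{k,1}² + λ_{k,2}².
open Polynomial in
theorem fidelity_maxCoupling (h₁ : IsEigendecomposition S.toBlocks₁₁ U₁ l₁)
    (h₂ : IsEigendecomposition S.toBlocks₂₂ U₂ l₂) (hl₁ : ∀ i, 0 ≤ l₁ i) (hl₂ : ∀ i, 0 ≤ l₂ i) :
    fidelity (maxCoupling S U₁ l₁ U₂ l₂) (blockPart S) = minFidelity l₁ l₂ := by
  rw [minFidelity]
  apply fidelity_eq_of_charpoly
  rw [maxCoupling_eq h₁ h₂ hl₁ hl₂, blockPart_eq h₁ h₂]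
  have hW := transpose_mul_fromBlocks h₁.transpose_mul h₂.transpose_mul
  set W := fromBlocks U₁ 0 0 U₂
  set F := stackedDiagonal (fun i => √(l₁ i)) (fun j => √(l₂ j))
  set D := diagonal (Sum.elim l₁ l₂)
  have hpad : ∀ {n : ℕ} {l : Fin n → ℝ}, (∀ i, 0 ≤ l i) → ∀ k : ℕ,
      pad (fun i => √(l i) ^ 2 * l i) k = pad l k ^ 2 := by
    intro n l hl k
    unfold pad
    split_ifs
    · simp only [Real.sq_sqrt (hl _), sq]
    · simp
  calc (W * (Fᵀ * F) * Wᵀ * (W * D * Wᵀ)).charpoly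
      = (W * ((Fᵀ * F) * (Wᵀ * W) * D * Wᵀ)).charpoly := by simp only [Matrix.mul_assoc]
    _ = (Fᵀ * (F * D)).charpoly := by
        rw [hW, charpoly_mul_comm, Matrix.mul_assoc (_ * D), hW]
        simp only [Matrix.mul_one, Matrix.mul_assoc]
    _ = (F * D * Fᵀ).charpoly := by
        -- F is square up to reindexing, so the power of X relating the two characteristic
        -- polynomials is trivial.
        rw [charpoly_mul_comm_of_le _ _ (by simp)]
        simp
    _ = _ := by
        rw [stackedDiagonal_mul_mul_transpose, charpoly_diagonal]
        simp only [hpad hl₁, hpad hl₂]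

theorem sSup_buresSq (hS : S.PosDef) (h₁ : IsEigendecomposition S.toBlocks₁₁ U₁ l₁)
    (h₂ : IsEigendecomposition S.toBlocks₂₂ U₂ l₂) :
    sSup ((fun T => buresSq T (blockPart S)) '' couplings S.toBlocks₁₁ S.toBlocks₂₂) =
      2 * (S.trace - minFidelity l₁ l₂) := by
  have hl₁ := h₁.pos (posDef_toBlocks₁₁ hS)
  have hl₂ := h₂.pos (posDef_toBlocks₂₂ hS)
  have hS₀ := (posDef_blockPart hS).posSemidef
  apply IsGreatest.csSup_eq
  constructor
  · refine ⟨maxCoupling S U₁ l₁ U₂ l₂, ⟨posSemidef_maxCoupling h₁ h₂ (fun i => (hl₁ i).le)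
      (fun i => (hl₂ i).le), _, rfl⟩, ?_⟩
    beta_reduce
    rw [buresSq_eq (posSemidef_maxCoupling h₁ h₂ (fun i => (hl₁ i).le)
      (fun i => (hl₂ i).le)) hS₀, fidelity_maxCoupling h₁ h₂ (fun i => (hl₁ i).le)
      (fun i => (hl₂ i).le), trace_blockPart, show (maxCoupling S U₁ l₁ U₂ l₂).trace = S.trace by
        rw [trace_eq_add S, trace_eq_add]; rfl]
    ring
  · rintro _ ⟨T, ⟨hT, Ψ, hΨ⟩, rfl⟩
    have hb : blockPart T = blockPart S := by rw [hΨ]; simp [blockPart]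
    have ht : T.trace = S.trace := by rw [← trace_blockPart, hb, trace_blockPart]
    have hle := minFidelity_le hT (U₁ := U₁) (U₂ := U₂) (l₁ := l₁) (l₂ := l₂)
      (by rw [hΨ]; simpa using h₁) (by rw [hΨ]; simpa using h₂) hl₁ hl₂
    rw [hb] at hle
    simp only
    rw [buresSq_eq hT hS₀, trace_blockPart, ht]
    linarith

theorem depTwo_eq (hS : S.PosDef) (h₁ : IsEigendecomposition S.toBlocks₁₁ U₁ l₁)
    (h₂ : IsEigendecomposition S.toBlocks₂₂ U₂ l₂) :
    depTwo S = (S.trace - fidelity S (blockPart S)) / (S.trace - minFidelity l₁ l₂) := by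
  rw [depTwo, sSup_buresSq hS h₁ h₂, buresSq_eq hS.posSemidef (posDef_blockPart hS).posSemidef,
    trace_blockPart, ← mul_div_mul_left _ (S.trace - minFidelity l₁ l₂) two_ne_zero]
  congr 1
  ring

theorem cTwo_eq (hS : S.PosDef) (h₁ : IsEigendecomposition S.toBlocks₁₁ U₁ l₁)
    (h₂ : IsEigendecomposition S.toBlocks₂₂ U₂ l₂) :
    cTwo S U₁ l₁ U₂ l₂ = S.trace - minFidelity l₁ l₂ := by
  have hl₁ := fun i => (h₁.pos (posDef_toBlocks₁₁ hS) i).le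
  have hl₂ := fun i => (h₂.pos (posDef_toBlocks₂₂ hS) i).le
  rw [cTwo, trace_msqrt_conj (posDef_blockPart hS).posSemidef
    (posSemidef_maxCoupling h₁ h₂ hl₁ hl₂), fidelity_comm, fidelity_maxCoupling h₁ h₂ hl₁ hl₂]

/-- √(a² + b²) ≤ a + b termwise, strictly at k = 0, where both entries are positive. Thus the
denominator of D₂ is nonzero. -/
theorem minFidelity_lt_trace (hp : 0 < p) (hq : 0 < q) (hS : S.PosDef)
    (h₁ : IsEigendecomposition S.toBlocks₁₁ U₁ l₁) (h₂ : IsEigendecomposition S.toBlocks₂₂ U₂ l₂) :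
    minFidelity l₁ l₂ < S.trace := by
  have hl₁ := h₁.pos (posDef_toBlocks₁₁ hS)
  have hl₂ := h₂.pos (posDef_toBlocks₂₂ hS)
  have hsum : S.trace = ∑ k : Fin (p + q), (pad l₁ k + pad l₂ k) := by
    rw [trace_eq_add, h₁.trace_eq, h₂.trace_eq, Finset.sum_add_distrib,
      sum_eq_sum_castLE (Nat.le_add_right p q) (fun k hk => pad_of_le l₁ hk),
      sum_eq_sum_castLE (Nat.le_add_left q p) (fun k hk => pad_of_le l₂ hk)]
    simp [pad_coe]
  rw [hsum, minFidelity]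
  have n1 := pad_nonneg fun i => (hl₁ i).le
  have n2 := pad_nonneg fun i => (hl₂ i).le
  refine Finset.sum_lt_sum (fun k _ => ?_) ⟨⟨0, by omega⟩, Finset.mem_univ _, ?_⟩
  · exact Real.sqrt_le_iff.2 ⟨add_nonneg (n1 _) (n2 _), by nlinarith [mul_nonneg (n1 k) (n2 k)]⟩
  · have p1 : 0 < pad l₁ 0 := by simpa [pad, hp] using hl₁ ⟨0, hp⟩
    have p2 : 0 < pad l₂ 0 := by simpa [pad, hq] using hl₂ ⟨0, hq⟩
    rw [Real.sqrt_lt' (by positivity)]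
    nlinarith [mul_pos p1 p2]

end Couplings

/-! ### First-order perturbation of simple eigenvalues -/

section Perturbation

/-- In the eigenbasis the residual has coordinates (lₖ - μ)vₖ; if every |lₖ - μ| exceeded δ, its
norm would exceed δ‖v‖. -/
theorem exists_abs_sub_le_of_residual {n : Type*} [Fintype n] [DecidableEq n]
    {B V : Matrix n n ℝ} {l : n → ℝ} (hV : Vᵀ * V = 1) (hB : B = V * diagonal l * Vᵀ)
    {v : n → ℝ} (hv : 0 < v ⬝ᵥ v) {μ δ : ℝ} (hδ : 0 ≤ δ)
    (h : (B *ᵥ v - μ • v) ⬝ᵥ (B *ᵥ v - μ • v) ≤ δ ^ 2 * (v ⬝ᵥ v)) : ∃ k, |l k - μ| ≤ δ := by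
  have hV' : V * Vᵀ = 1 := mul_eq_one_comm.1 hV
  have hiso : ∀ x : n → ℝ, (Vᵀ *ᵥ x) ⬝ᵥ (Vᵀ *ᵥ x) = x ⬝ᵥ x := fun x => by
    rw [dotProduct_mulVec, vecMul_transpose, mulVec_mulVec, hV', one_mulVec]
  have hres : Vᵀ *ᵥ (B *ᵥ v - μ • v) = fun k => (l k - μ) * (Vᵀ *ᵥ v) k := by
    rw [mulVec_sub, mulVec_mulVec, hB, ← Matrix.mul_assoc, ← Matrix.mul_assoc, hV, Matrix.one_mul,
      ← mulVec_mulVec, mulVec_smul]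
    ext k
    simp only [Pi.sub_apply, mulVec_diagonal, Pi.smul_apply, smul_eq_mul]
    ring
  by_contra! hk
  rw [← hiso, ← hiso v, hres] at h
  rw [← hiso v] at hv
  simp only [dotProduct, Finset.mul_sum] at h hv
  obtain ⟨k₀, hk₀⟩ : ∃ k, (Vᵀ *ᵥ v) k ≠ 0 := by
    by_contra! h0
    simp [h0] at hv
  refine h.not_gt (Finset.sum_lt_sum (fun k _ => ?_) ⟨k₀, Finset.mem_univ _, ?_⟩)
  · have h1 : δ ^ 2 ≤ (l k - μ) ^ 2 := by
      rw [← sq_abs (l k - μ)]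
      exact pow_le_pow_left₀ hδ (hk k).le 2
    nlinarith [mul_self_nonneg ((Vᵀ *ᵥ v) k)]
  · have h1 : δ ^ 2 < (l k₀ - μ) ^ 2 := by
      rw [← sq_abs (l k₀ - μ)]
      exact pow_lt_pow_left₀ (hk k₀) hδ two_ne_zero
    nlinarith [mul_self_pos.2 hk₀]

/-- For small t the intervals around the predicted values are disjoint and ordered, so the matching
i ↦ k is a strictly increasing self-map of `Fin n`, hence the identity. -/
theorem eventually_abs_sub_le_of_exists {n : ℕ} {l K : Fin n → ℝ} (hl : StrictAnti l)
    {L r : ℝ → Fin n → ℝ} (hL : ∀ᶠ t in 𝓝[>] 0, Antitone (L t))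
    (hr : ∀ i, Tendsto (fun t => r t i) (𝓝[>] 0) (𝓝 0))
    (h : ∀ᶠ t in 𝓝[>] 0, ∀ i, ∃ k, |L t k - (l i + t * K i)| ≤ t * r t i) :
    ∀ᶠ t in 𝓝[>] 0, ∀ i, |L t i - (l i + t * K i)| ≤ t * r t i := by
  have ht0 : Tendsto (fun t : ℝ => t) (𝓝[>] 0) (𝓝 0) := tendsto_nhdsWithin_of_tendsto_nhds tendsto_id
  have gap : ∀ᶠ t in 𝓝[>] 0, ∀ i j, i < j →
      l j + t * K j + t * r t j < l i + t * K i - t * r t i := by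
    refine eventually_all.2 fun i => eventually_all.2 fun j => ?_
    by_cases hij : i < j
    · have h1 : Tendsto (fun t => l j + t * K j + t * r t j) (𝓝[>] 0) (𝓝 (l j)) := by
        simpa using ((ht0.mul_const (K j)).const_add (l j)).add (ht0.mul (hr j))
      have h2 : Tendsto (fun t => l i + t * K i - t * r t i) (𝓝[>] 0) (𝓝 (l i)) := by
        simpa using ((ht0.mul_const (K i)).const_add (l i)).sub (ht0.mul (hr i))
      filter_upwards [h1.eventually_lt h2 (hl hij)] with t ht _ using ht
    · exact Eventually.of_forall fun t h' => absurd h' hij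
  filter_upwards [hL, h, gap] with t hLt ht hgap
  choose σ hσ using ht
  have hmono : StrictMono σ := by
    intro i j hij
    by_contra! hle
    have h1 := hLt hle
    have h2 := abs_le.1 (hσ i)
    have h3 := abs_le.1 (hσ j)
    linarith [hgap i j hij]
  intro i
  have hid : σ i = i := le_antisymm hmono.apply_le hmono.le_apply
  have := hσ i
  rwa [hid] at this

variable {n : ℕ} {A U : Matrix (Fin n) (Fin n) ℝ} {l : Fin n → ℝ}
  {Ht : ℝ → Matrix (Fin n) (Fin n) ℝ} {H : Matrix (Fin n) (Fin n) ℝ}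

theorem tendsto_slope_eigenvalue (h : IsEigendecomposition A U l) (hl : Function.Injective l)
    (hH : Tendsto Ht (𝓝[>] 0) (𝓝 H)) {V : ℝ → Matrix (Fin n) (Fin n) ℝ} {L : ℝ → Fin n → ℝ}
    (hL : ∀ t, 0 < t → IsEigendecomposition (A + t • Ht t) (V t) (L t)) (i : Fin n) :
    Tendsto (fun t => t⁻¹ * (L t i - l i)) (𝓝[>] 0) (𝓝 ((Uᵀ * H * U) i i)) := by
  have ht0 : Tendsto (fun t : ℝ => t) (𝓝[>] 0) (𝓝 0) := tendsto_nhdsWithin_of_tendsto_nhds tendsto_id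
  set K := Uᵀ * H * U
  set Kt : ℝ → Matrix (Fin n) (Fin n) ℝ := fun t => Uᵀ * Ht t * U
  have hK : Tendsto Kt (𝓝[>] 0) (𝓝 K) := (hH.const_mul Uᵀ).mul_const U
  -- First-order eigenvector correction in the basis U. It solves (lᵢ - lⱼ)wⱼ = Kⱼᵢ off the
  -- diagonal, which makes the residual t·ρ with ρ → 0; the zero at j = i keeps that coordinate of
  -- `v t i` equal to 1.
  set w : Fin n → Fin n → ℝ := fun i j => if j = i then 0 else K j i / (l i - l j) with hw
  set v : ℝ → Fin n → Fin n → ℝ := fun t i => Pi.single i 1 + t • w i with hv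
  set ρ : ℝ → Fin n → Fin n → ℝ := fun t i j => (Kt t *ᵥ v t i) j - K j i - t * (K i i * w i j)
  set r : ℝ → Fin n → ℝ := fun t i => √(ρ t i ⬝ᵥ ρ t i)
  have hvlim : ∀ i, Tendsto (fun t => v t i) (𝓝[>] 0) (𝓝 (Pi.single i 1)) := fun i => by
    simpa using (ht0.smul_const (w i)).const_add (Pi.single i (1 : ℝ))
  have hρ : ∀ i j, Tendsto (fun t => ρ t i j) (𝓝[>] 0) (𝓝 0) := by
    intro i j
    have h1 : Tendsto (fun t => (Kt t *ᵥ v t i) j) (𝓝[>] 0) (𝓝 (K j i)) := by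
      have h2 : Tendsto (fun t => ∑ k, Kt t j k * v t i k) (𝓝[>] 0)
          (𝓝 (∑ k, K j k * (Pi.single i 1 : Fin n → ℝ) k)) :=
        tendsto_finsetSum _ fun k _ =>
          (tendsto_matrix_iff.1 hK j k).mul (tendsto_pi_nhds.1 (hvlim i) k)
      simpa [Pi.single_apply, mulVec, dotProduct] using h2
    simpa using (h1.sub_const (K j i)).sub (ht0.mul_const (K i i * w i j))
  have hr : ∀ i, Tendsto (fun t => r t i) (𝓝[>] 0) (𝓝 0) := by
    intro i
    have h1 : Tendsto (fun t => ∑ j, ρ t i j * ρ t i j) (𝓝[>] 0) (𝓝 (∑ j : Fin n, 0 * 0)) :=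
      tendsto_finsetSum _ fun j _ => (hρ i j).mul (hρ i j)
    simpa [r, dotProduct] using h1.sqrt
  have hstrict : StrictAnti l := h.ordered.strictAnti_of_injective hl
  have hex : ∀ᶠ t in 𝓝[>] 0, ∀ i, ∃ k, |L t k - (l i + t * K i i)| ≤ t * r t i := by
    filter_upwards [self_mem_nhdsWithin] with t ht i
    have hdec : Uᵀ * (A + t • Ht t) * U = diagonal l + t • Kt t := by
      rw [mul_add, add_mul, h.transpose_mul_mul, mul_smul_comm, smul_mul_assoc]
    have hvi : v t i i = 1 := by simp [hv, hw]
    have hvv : 1 ≤ v t i ⬝ᵥ v t i := by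
      have := Finset.single_le_sum (f := fun j => v t i j * v t i j)
        (fun j _ => mul_self_nonneg _) (Finset.mem_univ i)
      simpa [hvi, dotProduct] using this
    have hres : (diagonal l + t • Kt t) *ᵥ v t i - (l i + t * K i i) • v t i = t • ρ t i := by
      ext j
      simp only [add_mulVec, smul_mulVec, Pi.sub_apply, Pi.add_apply, mulVec_diagonal,
        Pi.smul_apply, smul_eq_mul, ρ]
      by_cases hj : j = i
      · subst hj
        rw [hvi]
        simp only [hw, if_true]
        ring
      · have h1 : v t i j = t * w i j := by simp [hv, hj]
        have h2 : (l i - l j) * w i j = K j i := by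
          have : l i - l j ≠ 0 := sub_ne_zero.2 fun h' => hj (hl h').symm
          simp only [hw, if_neg hj]
          field_simp
        rw [h1, ← h2]
        ring
    refine exists_abs_sub_le_of_residual (B := diagonal l + t • Kt t) (V := Uᵀ * V t) (v := v t i)
      ?_ ?_ (by linarith) (mul_nonneg (le_of_lt ht) (Real.sqrt_nonneg _)) ?_
    · rw [transpose_mul, transpose_transpose, Matrix.mul_assoc, ← Matrix.mul_assoc U,
        h.mul_transpose, Matrix.one_mul, (hL t ht).transpose_mul]
    · rw [← hdec, transpose_mul, transpose_transpose]
      conv_lhs => rw [(hL t ht).eq]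
      simp only [Matrix.mul_assoc]
    · have h0 : 0 ≤ ρ t i ⬝ᵥ ρ t i := Finset.sum_nonneg fun j _ => mul_self_nonneg _
      rw [hres, smul_dotProduct, dotProduct_smul, mul_pow, Real.sq_sqrt h0]
      simp only [smul_eq_mul]
      nlinarith [mul_nonneg (sq_nonneg t) h0]
  have hfin := eventually_abs_sub_le_of_exists (K := fun i => K i i) hstrict
    (by filter_upwards [self_mem_nhdsWithin] with t ht using (hL t ht).ordered) hr hex
  rw [tendsto_iff_norm_sub_tendsto_zero]
  refine tendsto_of_tendsto_of_tendsto_of_le_of_le' tendsto_const_nhds (hr i)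
    (Eventually.of_forall fun t => norm_nonneg _) ?_
  filter_upwards [hfin, self_mem_nhdsWithin] with t ht1 ht
  have ht' : 0 < t := ht
  have h1 : t⁻¹ * (L t i - l i) - K i i = t⁻¹ * (L t i - (l i + t * K i i)) := by
    field_simp
    ring
  rw [Real.norm_eq_abs, h1, abs_mul, abs_of_pos (inv_pos.2 ht'), inv_mul_le_iff₀ ht']
  exact ht1 i

theorem hasDerivWithinAt_iff_tendsto_inv_mul {f : ℝ → ℝ} {f' : ℝ} :
    HasDerivWithinAt f f' (Set.Ioi 0) 0 ↔
      Tendsto (fun t => t⁻¹ * (f t - f 0)) (𝓝[>] 0) (𝓝 f') := by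
  rw [hasDerivWithinAt_iff_tendsto_slope' (by simp)]
  simp [slope_fun_def]

theorem exists_eigenvalue_path (h : IsEigendecomposition A U l) (hl : Function.Injective l)
    (hA : A.IsSymm) (hHs : ∀ t, 0 < t → (Ht t).IsSymm) (hH : Tendsto Ht (𝓝[>] 0) (𝓝 H)) :
    ∃ (V : ℝ → Matrix (Fin n) (Fin n) ℝ) (L : ℝ → Fin n → ℝ), L 0 = l ∧
      (∀ t, 0 < t → IsEigendecomposition (A + t • Ht t) (V t) (L t)) ∧
      ∀ i, HasDerivWithinAt (fun t => L t i) ((Uᵀ * H * U) i i) (Set.Ioi 0) 0 := by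
  have hex : ∀ t : ℝ, ∃ V L, (t = 0 → L = l) ∧
      (0 < t → IsEigendecomposition (A + t • Ht t) V L) := by
    intro t
    by_cases ht : 0 < t
    · have hs : (A + t • Ht t).IsHermitian := by
        rw [IsHermitian, conjTranspose_eq_transpose_of_trivial]
        exact hA.add ((hHs t ht).smul t)
      obtain ⟨V, L, hVL⟩ := exists_isEigendecomposition hs
      exact ⟨V, L, fun h0 => absurd h0 ht.ne', fun _ => hVL⟩
    · exact ⟨U, l, fun _ => rfl, fun h0 => absurd h0 ht⟩
  choose V L hL0 hL using hex
  refine ⟨V, L, hL0 0 rfl, hL, fun i => ?_⟩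
  rw [hasDerivWithinAt_iff_tendsto_inv_mul, hL0 0 rfl]
  exact tendsto_slope_eigenvalue h hl hH hL i

theorem hasDerivWithinAt_pad {L : ℝ → Fin n → ℝ} {d : Fin n → ℝ} {s : Set ℝ} {x : ℝ}
    (h : ∀ i, HasDerivWithinAt (fun t => L t i) (d i) s x) (k : ℕ) :
    HasDerivWithinAt (fun t => pad (L t) k) (pad d k) s x := by
  unfold pad
  split_ifs
  exacts [h _, hasDerivWithinAt_const _ _ _]

theorem hasDerivWithinAt_minFidelity {p q : ℕ} {L₁ : ℝ → Fin p → ℝ} {L₂ : ℝ → Fin q → ℝ}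
    {d₁ : Fin p → ℝ} {d₂ : Fin q → ℝ} {s : Set ℝ} {x : ℝ} (hL₁ : ∀ i, 0 < L₁ x i)
    (hL₂ : ∀ i, 0 < L₂ x i) (h₁ : ∀ i, HasDerivWithinAt (fun t => L₁ t i) (d₁ i) s x)
    (h₂ : ∀ i, HasDerivWithinAt (fun t => L₂ t i) (d₂ i) s x) :
    HasDerivWithinAt (fun t => minFidelity (L₁ t) (L₂ t))
      (∑ i, L₁ x i / √(L₁ x i ^ 2 + pad (L₂ x) i ^ 2) * d₁ i +
        ∑ j, L₂ x j / √(L₂ x j ^ 2 + pad (L₁ x) j ^ 2) * d₂ j) s x := by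
  have e1 : ∑ i, L₁ x i / √(L₁ x i ^ 2 + pad (L₂ x) i ^ 2) * d₁ i = ∑ k : Fin (p + q),
      pad (L₁ x) k / √(pad (L₁ x) k ^ 2 + pad (L₂ x) k ^ 2) * pad d₁ k := by
    rw [sum_eq_sum_castLE (Nat.le_add_right p q) (fun k hk => by rw [pad_of_le d₁ hk, mul_zero])]
    simp [pad_coe]
  have e2 : ∑ j, L₂ x j / √(L₂ x j ^ 2 + pad (L₁ x) j ^ 2) * d₂ j = ∑ k : Fin (p + q),
      pad (L₂ x) k / √(pad (L₁ x) k ^ 2 + pad (L₂ x) k ^ 2) * pad d₂ k := by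
    rw [sum_eq_sum_castLE (Nat.le_add_left q p) (fun k hk => by rw [pad_of_le d₂ hk, mul_zero])]
    simp [pad_coe, add_comm]
  rw [e1, e2, ← Finset.sum_add_distrib]
  unfold minFidelity
  refine HasDerivWithinAt.fun_sum fun k _ => ?_
  -- Beyond both lengths the summand is the constant √0, where the chain rule for the square root is
  -- unavailable.
  by_cases hk : p ≤ (k : ℕ) ∧ q ≤ (k : ℕ)
  · simp only [pad_of_le _ hk.1, pad_of_le _ hk.2]
    simpa using hasDerivWithinAt_const x s (0 : ℝ)
  · have hpos : 0 < pad (L₁ x) k ^ 2 + pad (L₂ x) k ^ 2 := by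
      rcases not_and_or.1 hk with hk | hk <;> rw [not_le] at hk
      · have : 0 < pad (L₁ x) k := by rw [pad, dif_pos hk]; exact hL₁ _
        positivity
      · have : 0 < pad (L₂ x) k := by rw [pad, dif_pos hk]; exact hL₂ _
        positivity
    have hd := (((hasDerivWithinAt_pad h₁ k).pow 2).add ((hasDerivWithinAt_pad h₂ k).pow 2)).sqrt
      hpos.ne'
    refine hd.congr_deriv ?_
    have := (Real.sqrt_pos.2 hpos).ne'
    simp only [Pi.add_apply, Pi.pow_apply, Nat.cast_ofNat, Nat.add_one_sub_one, pow_one]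
    field_simp

end Perturbation

/-! ### Trace identities for the gradient -/

section Derivative

variable {p q : ℕ}

/-- Block truncation is self-adjoint for the trace pairing; this turns tr(H₀J) into tr(J₀H). -/
theorem trace_blockPart_mul (A B : Matrix (Fin p ⊕ Fin q) (Fin p ⊕ Fin q) ℝ) :
    (blockPart A * B).trace = (A * blockPart B).trace := by
  conv_lhs => rw [← fromBlocks_toBlocks B]
  conv_rhs => rw [← fromBlocks_toBlocks A]
  rw [blockPart, blockPart, fromBlocks_multiply, fromBlocks_multiply, trace_eq_add, trace_eq_add]
  simp

theorem trace_upsilonTwo_mul (U₁ : Matrix (Fin p) (Fin p) ℝ) (l₁ : Fin p → ℝ)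
    (U₂ : Matrix (Fin q) (Fin q) ℝ) (l₂ : Fin q → ℝ)
    (H : Matrix (Fin p ⊕ Fin q) (Fin p ⊕ Fin q) ℝ) :
    (upsilonTwo U₁ l₁ U₂ l₂ * H).trace =
      ∑ i, l₁ i / √(l₁ i ^ 2 + pad l₂ i ^ 2) * (U₁ᵀ * H.toBlocks₁₁ * U₁) i i +
        ∑ j, l₂ j / √(l₂ j ^ 2 + pad l₁ j ^ 2) * (U₂ᵀ * H.toBlocks₂₂ * U₂) j j := by
  have key : ∀ {n : ℕ} (U K : Matrix (Fin n) (Fin n) ℝ) (e : Fin n → ℝ),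
      (U * diagonal e * Uᵀ * K).trace = ∑ i, e i * (Uᵀ * K * U) i i := by
    intro n U K e
    rw [Matrix.mul_assoc, Matrix.mul_assoc, trace_mul_comm, Matrix.mul_assoc]
    simp [trace, diagonal_mul]
  conv_lhs => rw [← fromBlocks_toBlocks H]
  rw [upsilonTwo, fromBlocks_multiply, trace_eq_add]
  simp [deltaPrime, key]

theorem blockPart_add_smul (S H : Matrix (Fin p ⊕ Fin q) (Fin p ⊕ Fin q) ℝ) (t : ℝ) :
    blockPart (S + t • H) = blockPart S + t • blockPart H := by
  ext i j
  rcases i with i | i <;> rcases j with j | j <;>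
    simp [blockPart, toBlocks₁₁, toBlocks₂₂]

theorem isSymm_blockPart {H : Matrix (Fin p ⊕ Fin q) (Fin p ⊕ Fin q) ℝ} (h : H.IsSymm) :
    (blockPart H).IsSymm := by
  ext i j
  rcases i with i | i <;> rcases j with j | j <;>
    simp [blockPart, toBlocks₁₁, toBlocks₂₂, h.apply]

end Derivative

end QuasiGaussian

/-! ### Quotient rule for D₂ -/

open QuasiGaussian in
theorem mainTheorem5 {p q : ℕ} (hp : 0 < p) (hq : 0 < q)
    (S : Matrix (Fin p ⊕ Fin q) (Fin p ⊕ Fin q) ℝ) (hS : S.PosDef)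
    (U₁ : Matrix (Fin p) (Fin p) ℝ) (l₁ : Fin p → ℝ)
    (U₂ : Matrix (Fin q) (Fin q) ℝ) (l₂ : Fin q → ℝ)
    (h₁ : QuasiGaussian.IsEigendecomposition S.toBlocks₁₁ U₁ l₁)
    (h₂ : QuasiGaussian.IsEigendecomposition S.toBlocks₂₂ U₂ l₂)
    (hl₁ : Function.Injective l₁) (hl₂ : Function.Injective l₂)
    (Ht : ℝ → Matrix (Fin p ⊕ Fin q) (Fin p ⊕ Fin q) ℝ)
    (H : Matrix (Fin p ⊕ Fin q) (Fin p ⊕ Fin q) ℝ)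
    (hHt : ∀ t, 0 < t → (Ht t).IsSymm) (hH : H.IsSymm)
    (hlim : ∀ i j, Tendsto (fun t => Ht t i j) (𝓝[>] 0) (𝓝 (H i j))) :
    Tendsto
      (fun t : ℝ =>
        t⁻¹ * (QuasiGaussian.depTwo (S + t • Ht t) - QuasiGaussian.depTwo S))
      (𝓝[>] 0)
      (𝓝 (QuasiGaussian.MTwo S U₁ l₁ U₂ l₂ * H).trace) := by
  have hHlim : Tendsto Ht (𝓝[>] 0) (𝓝 H) := tendsto_matrix_iff.2 hlim
  have hblim : Tendsto (fun t => blockPart (Ht t)) (𝓝[>] 0) (𝓝 (blockPart H)) := by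
    rw [tendsto_matrix_iff]
    rintro (i | i) (j | j)
    exacts [hlim _ _, tendsto_const_nhds, tendsto_const_nhds, hlim _ _]
  have hSs : S.IsSymm := by
    have := hS.isHermitian.eq
    rwa [conjTranspose_eq_transpose_of_trivial] at this
  have ht0 : Tendsto (fun t : ℝ => t) (𝓝[>] 0) (𝓝 0) := tendsto_nhdsWithin_of_tendsto_nhds tendsto_id
  have hpd : ∀ᶠ t in 𝓝[>] 0, (S + t • Ht t).PosDef := by
    refine eventually_posDef hS ?_ (by simpa using (ht0.smul hHlim).const_add S)
    filter_upwards [self_mem_nhdsWithin] with t ht using hSs.add ((hHt t ht).smul t)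
  obtain ⟨V₁, L₁, hL₁0, hL₁, hd₁⟩ := exists_eigenvalue_path (Ht := fun t => (Ht t).toBlocks₁₁)
    (H := H.toBlocks₁₁) h₁ hl₁ (hSs.submatrix Sum.inl) (fun t ht => (hHt t ht).submatrix Sum.inl)
    (tendsto_matrix_iff.2 fun i j => hlim _ _)
  obtain ⟨V₂, L₂, hL₂0, hL₂, hd₂⟩ := exists_eigenvalue_path (Ht := fun t => (Ht t).toBlocks₂₂)
    (H := H.toBlocks₂₂) h₂ hl₂ (hSs.submatrix Sum.inr) (fun t ht => (hHt t ht).submatrix Sum.inr)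
    (tendsto_matrix_iff.2 fun i j => hlim _ _)
  have dG := hasDerivWithinAt_minFidelity (by rw [hL₁0]; exact h₁.pos (posDef_toBlocks₁₁ hS))
    (by rw [hL₂0]; exact h₂.pos (posDef_toBlocks₂₂ hS)) hd₁ hd₂
  rw [hL₁0, hL₂0, ← trace_upsilonTwo_mul] at dG
  have dT : HasDerivWithinAt (fun t : ℝ => (S + t • Ht t).trace) H.trace (Set.Ioi 0) 0 := by
    rw [hasDerivWithinAt_iff_tendsto_inv_mul]
    refine ((continuous_id.matrix_trace.tendsto H).comp hHlim).congr' ?_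
    filter_upwards [self_mem_nhdsWithin] with t ht
    have : t ≠ 0 := ne_of_gt ht
    simp [this]
  have dF : HasDerivWithinAt (fun t : ℝ => fidelity (S + t • Ht t) (blockPart (S + t • Ht t)))
      (((H * (transportJ S)⁻¹).trace + (blockPart H * transportJ S).trace) / 2)
      (Set.Ioi 0) 0 := by
    rw [hasDerivWithinAt_iff_tendsto_inv_mul]
    have := tendsto_slope_fidelity hS (posDef_blockPart hS) hHt
      (fun t ht => isSymm_blockPart (hHt t ht)) hHlim hblim
    simp only [blockPart_add_smul, zero_smul, add_zero]
    exact this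
  have hc := minFidelity_lt_trace hp hq hS h₁ h₂
  have dQ := (dT.sub dF).div (dT.sub dG) (by simpa [hL₁0, hL₂0] using (sub_pos.2 hc).ne')
  -- The closed form holds for any ordered eigendecompositions of the blocks, so the arbitrarily
  -- chosen ones at t > 0 may be used alongside the given ones at t = 0.
  have dD := dQ.congr_of_eventuallyEq (f₁ := fun t : ℝ => depTwo (S + t • Ht t))
    (by
      filter_upwards [hpd, self_mem_nhdsWithin] with t ht1 ht
      exact depTwo_eq ht1 (hL₁ t ht) (hL₂ t ht))
    (by simp [hL₁0, hL₂0, depTwo_eq hS h₁ h₂])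
  rw [hasDerivWithinAt_iff_tendsto_inv_mul] at dD
  simp only [zero_smul, add_zero, Pi.sub_apply, hL₁0, hL₂0] at dD
  convert dD using 2
  rw [MTwo, cTwo_eq hS h₁ h₂, depTwo_eq hS h₁ h₂]
  simp only [smul_mul_assoc, add_mul, neg_mul, trace_smul, trace_add, trace_neg, Matrix.one_mul,
    smul_eq_mul, trace_blockPart_mul]
  rw [trace_mul_comm H (transportJ S)⁻¹, trace_mul_comm H (blockPart (transportJ S)),
    trace_blockPart_mul]
  have hc' := (sub_pos.2 hc).ne'
  field_simp
  ring
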